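/- Let $d\ge 0$ be an integer, let $\gamma_d$ be the standard Gaussian measure on $\mathbb{R}^d$, and let $V,W:\mathbb{R}^d\to\mathbb{R}\cup\{+\infty\}$ be convex functions such that $\mu(dx)=e^{V(x)}\gamma_d(dx)$ and $\nu(dx)=e^{-W(x)}\gamma_d(dx)$ are probability measures. Assume that $\mu$ has a finite second moment, that $\nu$ is compactly supported, and that $V$ is bounded from below. For $\varepsilon>0$ let $R^\varepsilon$ be the law of $\bigl(X,\;e^{-\varepsilon/2}X+\sqrt{1-e^{-\varepsilon}}\,Y\bigr)$, where $X,Y$ are independent standard Gaussian vectors in $\mathbb{R}^d$ (the joint law of $(Z_0,Z_\varepsilon)$ for the Ornstein–Uhlenbeck process $dZ_t=-\tfrac12 Z_t\,dt+dW_t$, $Z_0\sim\gamma_d$). For probability measures $\alpha,\beta$ on $\mathbb{R}^d$ let $$\mathcal{T}_H^\varepsilon(\alpha,\beta)=\inf_{\pi} H(\pi\,|\,R^\varepsilon)\in[0,+\infty],$$ where the infimum runs over all couplings $\pi$ of $\alpha$ and $\beta$ (probability measures on $\mathbb{R}^d\times\mathbb{R}^d$ with marginals $\alpha$ and $\beta$),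 and $H(\pi|R)=\int\log\frac{d\pi}{dR}\,d\pi$ if $\pi\ll R$, $H(\pi|R)=+\infty$ otherwise. For probability measures $\eta_1,\eta_2$ on $\mathbb{R}^d$ with finite first moments, write $\eta_1\le_c\eta_2$ if $\int f\,d\eta_1\le\int f\,d\eta_2$ (as an inequality in $(-\infty,+\infty]$) for every convex function $f:\mathbb{R}^d\to\mathbb{R}$. Then for every $\varepsilon>0$ and every probability measure $\eta$ on $\mathbb{R}^d$ with a finite first moment such that $\eta\le_c\nu$, $$\mathcal{T}_H^\varepsilon(\mu,\eta)\;\ge\;\mathcal{T}_H^\varepsilon(\mu,\nu).$$ -/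

import Mathlib

open MeasureTheory ProbabilityTheory
open scoped ENNReal

/-- A convex function `F : E → ℝ ∪ {+∞}`: it never takes the value `-∞`, and the usual convexity
inequality holds in the extended reals. -/
structure IsConvexExt {E : Type*} [AddCommGroup E] [Module ℝ E] (F : E → EReal) : Prop where
  ne_bot : ∀ x, F x ≠ ⊥
  le_combo : ∀ (x y : E) (a b : ℝ), 0 < a → 0 < b → a + b = 1 →
    F (a • x + b • y) ≤ (a : EReal) * F x + (b : EReal) * F y

/-- The convex order `η₁ ≤_c η₂` between measures with a finite first moment:
`∫ f dη₁ ≤ ∫ f dη₂` for every convex `f : E → ℝ`. Such an `f` is bounded below by an affine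
function, so both integrals make sense in `(-∞, +∞]`; the inequality in `(-∞, +∞]` says that
if the right-hand side is finite then so is the left-hand side, and it is at most the right. -/
structure ConvexOrderLE {E : Type*} [NormedAddCommGroup E] [NormedSpace ℝ E] [MeasurableSpace E]
    (η₁ η₂ : Measure E) : Prop where
  integrable_left : Integrable (fun x : E => x) η₁
  integrable_right : Integrable (fun x : E => x) η₂
  integral_le : ∀ f : E → ℝ, ConvexOn ℝ Set.univ f → Integrable f η₂ →
    Integrable f η₁ ∧ ∫ x, f x ∂η₁ ≤ ∫ x, f x ∂η₂

/-- The set of couplings of `μ` and `ν`. -/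
def couplingSet {E : Type*} [MeasurableSpace E] (μ ν : Measure E) : Set (Measure (E × E)) :=
  {π | IsProbabilityMeasure π ∧ π.map Prod.fst = μ ∧ π.map Prod.snd = ν}

/-- The law `R^ε` of `(X, e^{-ε/2} X + √(1 - e^{-ε}) Y)`, with `X`, `Y` independent standard
Gaussian vectors of `ℝ^d`: the joint law of `(Z_0, Z_ε)` for the stationary Ornstein-Uhlenbeck
process `dZ_t = -Z_t/2 dt + dW_t`. -/
noncomputable def ouCoupling (d : ℕ) (ε : ℝ) :
    Measure (EuclideanSpace ℝ (Fin d) × EuclideanSpace ℝ (Fin d)) :=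
  ((stdGaussian (EuclideanSpace ℝ (Fin d))).prod (stdGaussian (EuclideanSpace ℝ (Fin d)))).map
    (fun p => (p.1, Real.exp (-ε / 2) • p.1 + Real.sqrt (1 - Real.exp (-ε)) • p.2))

/-- The entropic transport cost: the infimum over couplings `π` of `μ` and `ν` of the relative
entropy `H(π | R^ε)`, a value in `[0, +∞]`. -/
noncomputable def entropicCost {d : ℕ} (ε : ℝ) (μ ν : Measure (EuclideanSpace ℝ (Fin d))) :
    ℝ≥0∞ :=
  ⨅ π ∈ couplingSet μ ν, InformationTheory.klDiv π (ouCoupling d ε)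

open scoped Pointwise in
/-- One-dimensional Brunn-Minkowski inequality, in its weighted form. -/
theorem Real.volume_add_volume_le_of_combo_mem {A B S : Set ℝ} (hA : MeasurableSet A)
    (hB : MeasurableSet B) (hA' : A.Nonempty) (hB' : B.Nonempty) {a b : ℝ} (ha : 0 < a)
    (hb : 0 < b) (h : ∀ x ∈ A, ∀ y ∈ B, a * x + b * y ∈ S) :
    ENNReal.ofReal a * volume A + ENNReal.ofReal b * volume B ≤ volume S := by
  have key : ∀ K₁ K₂ : Set ℝ, K₁ ⊆ A → K₂ ⊆ B → IsCompact K₁ → IsCompact K₂ → K₁.Nonempty →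
      K₂.Nonempty → ENNReal.ofReal a * volume K₁ + ENNReal.ofReal b * volume K₂ ≤ volume S := by
    intro K₁ K₂ h₁ h₂ c₁ c₂ n₁ n₂
    obtain ⟨m₁, hm₁, hmax⟩ := c₁.exists_isGreatest n₁
    obtain ⟨m₂, hm₂, hmin⟩ := c₂.exists_isLeast n₂
    set T₁ := (fun x => a * x + b * m₂) '' K₁ with hT₁
    set T₂ := (fun y => a * m₁ + b * y) '' K₂ with hT₂
    have cT₁ : IsCompact T₁ := c₁.image (by fun_prop)
    have cT₂ : IsCompact T₂ := c₂.image (by fun_prop)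
    have v₁ : volume T₁ = ENNReal.ofReal a * volume K₁ := by
      have : T₁ = (fun x => x + b * m₂) '' (a • K₁) := by
        rw [← Set.image_smul, Set.image_image]; rfl
      rw [this, Set.image_add_right, measure_preimage_add_right, Measure.addHaar_smul]
      simp [abs_of_pos ha]
    have v₂ : volume T₂ = ENNReal.ofReal b * volume K₂ := by
      have : T₂ = (fun x => a * m₁ + x) '' (b • K₂) := by
        rw [← Set.image_smul, Set.image_image]; rfl
      rw [this, Set.image_add_left, measure_preimage_add, Measure.addHaar_smul]
      simp [abs_of_pos hb]
    have hdisj : AEDisjoint volume T₁ T₂ := by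
      refine measure_mono_null (t := {a * m₁ + b * m₂}) ?_ (by simp)
      rintro _ ⟨⟨x, hx, rfl⟩, ⟨y, hy, hxy⟩⟩
      have := hmax hx
      have := hmin hy
      simp only [Set.mem_singleton_iff] at *
      nlinarith [mul_le_mul_of_nonneg_left (hmax hx) ha.le,
        mul_le_mul_of_nonneg_left (hmin hy) hb.le]
    rw [← v₁, ← v₂, ← measure_union₀ cT₂.measurableSet.nullMeasurableSet hdisj]
    refine measure_mono (Set.union_subset ?_ ?_)
    · rintro _ ⟨x, hx, rfl⟩
      exact h _ (h₁ hx) _ (h₂ hm₂)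
    · rintro _ ⟨x, hx, rfl⟩
      exact h _ (h₁ hm₁) _ (h₂ hx)
  have approx : ∀ T : Set ℝ, MeasurableSet T → T.Nonempty → ∀ r < volume T, ∃ K ⊆ T, IsCompact K ∧
      K.Nonempty ∧ r ≤ volume K := by
    rintro T hT ⟨x, hx⟩ r hr
    obtain ⟨K, hK, cK, hrK⟩ := hT.exists_lt_isCompact hr
    exact ⟨insert x K, Set.insert_subset hx hK, cK.insert x, ⟨x, by simp⟩,
      hrK.le.trans (measure_mono (Set.subset_insert _ _))⟩
  have step : ∀ K₂ ⊆ B, IsCompact K₂ → K₂.Nonempty →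
      ENNReal.ofReal a * volume A + ENNReal.ofReal b * volume K₂ ≤ volume S := by
    intro K₂ h₂ c₂ n₂
    rcases eq_or_ne (volume A) 0 with h0 | h0
    · obtain ⟨x, hx⟩ := hA'
      have := key {x} K₂ (by simpa using hx) h₂ isCompact_singleton c₂ (by simp) n₂
      simpa [h0] using this
    · have hcont : Filter.Tendsto (fun r => ENNReal.ofReal a * r + ENNReal.ofReal b * volume K₂)
          (nhdsWithin (volume A) (Set.Iio (volume A)))
          (nhds (ENNReal.ofReal a * volume A + ENNReal.ofReal b * volume K₂)) := by
        refine Filter.Tendsto.add ?_ tendsto_const_nhds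
        exact (ENNReal.continuous_const_mul ENNReal.ofReal_ne_top).tendsto _ |>.mono_left
          nhdsWithin_le_nhds
      have : (nhdsWithin (volume A) (Set.Iio (volume A))).NeBot :=
        nhdsLT_neBot_of_exists_lt ⟨0, pos_iff_ne_zero.2 h0⟩
      refine le_of_tendsto hcont ?_
      filter_upwards [self_mem_nhdsWithin] with r hr
      obtain ⟨K, hK, cK, nK, hrK⟩ := approx A hA hA' r hr
      exact le_trans (by gcongr) (key K K₂ hK h₂ cK c₂ nK n₂)
  rcases eq_or_ne (volume B) 0 with h0 | h0
  · obtain ⟨x, hx⟩ := hB'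
    have := step {x} (by simpa using hx) isCompact_singleton (by simp)
    simpa [h0] using this
  · have hcont : Filter.Tendsto (fun r => ENNReal.ofReal a * volume A + ENNReal.ofReal b * r)
        (nhdsWithin (volume B) (Set.Iio (volume B)))
        (nhds (ENNReal.ofReal a * volume A + ENNReal.ofReal b * volume B)) := by
      refine Filter.Tendsto.add tendsto_const_nhds ?_
      exact (ENNReal.continuous_const_mul ENNReal.ofReal_ne_top).tendsto _ |>.mono_left
        nhdsWithin_le_nhds
    have : (nhdsWithin (volume B) (Set.Iio (volume B))).NeBot :=
      nhdsLT_neBot_of_exists_lt ⟨0, pos_iff_ne_zero.2 h0⟩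
    refine le_of_tendsto hcont ?_
    filter_upwards [self_mem_nhdsWithin] with r hr
    obtain ⟨K, hK, cK, nK, hrK⟩ := approx B hB hB' r hr
    exact le_trans (by gcongr) (step K hK cK nK)

/-- The normalised one-dimensional Prékopa-Leindler inequality, for functions of supremum one. -/
theorem Real.lintegral_add_lintegral_le_of_sup_eq_one {f g h : ℝ → ℝ} (hf : Measurable f)
    (hg : Measurable g) (hh : Measurable h) (hf0 : 0 ≤ f) (hg0 : 0 ≤ g) (hh0 : 0 ≤ h)
    (hf1 : ∀ x, f x ≤ 1) (hg1 : ∀ x, g x ≤ 1) (hfs : ∀ t < 1, ∃ x, t < f x)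
    (hgs : ∀ t < 1, ∃ x, t < g x) {a b : ℝ} (ha : 0 < a) (hb : 0 < b)
    (H : ∀ x y t, 0 < t → t < f x → t < g y → t < h (a * x + b * y)) :
    ENNReal.ofReal a * (∫⁻ x, ENNReal.ofReal (f x)) +
      ENNReal.ofReal b * (∫⁻ x, ENNReal.ofReal (g x))
      ≤ ∫⁻ x, ENNReal.ofReal (h x) := by
  have hanti : ∀ k : ℝ → ℝ, Measurable (fun t : ℝ => volume {x | t < k x}) := fun k =>
    Antitone.measurable fun s t hst => measure_mono fun x (hx : t < k x) => lt_of_le_of_lt hst hx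
  rw [lintegral_eq_lintegral_meas_lt _ (Filter.Eventually.of_forall hf0) hf.aemeasurable,
    lintegral_eq_lintegral_meas_lt _ (Filter.Eventually.of_forall hg0) hg.aemeasurable,
    lintegral_eq_lintegral_meas_lt _ (Filter.Eventually.of_forall hh0) hh.aemeasurable,
    ← lintegral_const_mul _ (hanti f), ← lintegral_const_mul _ (hanti g),
    ← lintegral_add_left ((hanti f).const_mul _)]
  refine lintegral_mono_ae ?_
  filter_upwards [ae_restrict_mem measurableSet_Ioi] with t ht
  rcases lt_or_ge t 1 with h1 | h1
  · exact Real.volume_add_volume_le_of_combo_mem (measurableSet_lt measurable_const hf)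
      (measurableSet_lt measurable_const hg) (hfs t h1) (hgs t h1) ha hb
      fun x hx y hy => H x y t ht hx hy
  · have e1 : {x | t < f x} = ∅ := by
      ext x; simpa using (hf1 x).trans h1
    have e2 : {x | t < g x} = ∅ := by
      ext x; simpa using (hg1 x).trans h1
    simp [e1, e2]

theorem ENNReal.geom_mean_le_arith_mean2_weighted {a b : ℝ} (ha : 0 < a) (hb : 0 < b)
    (hab : a + b = 1) (x y : ℝ≥0∞) :
    x ^ a * y ^ b ≤ ENNReal.ofReal a * x + ENNReal.ofReal b * y := by
  have ha' : ENNReal.ofReal a ≠ 0 := by simpa using ha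
  have hb' : ENNReal.ofReal b ≠ 0 := by simpa using hb
  induction x with
  | top => simp [ENNReal.mul_top ha']
  | coe x =>
    induction y with
    | top => simp [ENNReal.mul_top hb']
    | coe y =>
      have := NNReal.geom_mean_le_arith_mean2_weighted a.toNNReal b.toNNReal x y
        (by rw [← Real.toNNReal_add ha.le hb.le, hab, Real.toNNReal_one])
      rw [Real.coe_toNNReal _ ha.le, Real.coe_toNNReal _ hb.le] at this
      rw [← ENNReal.coe_rpow_of_nonneg _ ha.le, ← ENNReal.coe_rpow_of_nonneg _ hb.le,
        ENNReal.ofReal, ENNReal.ofReal]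
      exact_mod_cast this

theorem Real.prekopa_leindler_of_bounded {F G H : ℝ → ℝ≥0∞} (hF : Measurable F) (hG : Measurable G)
    (hH : Measurable H) {M : ℝ≥0∞} (hM : M ≠ ∞) (hFM : ∀ x, F x ≤ M) (hGM : ∀ x, G x ≤ M) {a b : ℝ}
    (ha : 0 < a) (hb : 0 < b) (hab : a + b = 1)
    (h : ∀ x y, F x ^ a * G y ^ b ≤ H (a * x + b * y)) :
    (∫⁻ x, F x) ^ a * (∫⁻ x, G x) ^ b ≤ ∫⁻ x, H x := by
  set α := ⨆ x, F x with hα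
  set β := ⨆ x, G x with hβ
  rcases eq_or_ne α 0 with hα0 | hα0
  · have : ∀ x, F x = 0 := by simpa [hα] using hα0
    simp [this, ha]
  rcases eq_or_ne β 0 with hβ0 | hβ0
  · have : ∀ x, G x = 0 := by simpa [hβ] using hβ0
    simp [this, hb]
  have hαt : α ≠ ∞ := ne_top_of_le_ne_top hM (iSup_le hFM)
  have hβt : β ≠ ∞ := ne_top_of_le_ne_top hM (iSup_le hGM)
  have hF1 : ∀ x, F x / α ≤ 1 := fun x => ENNReal.div_le_of_le_mul (by simpa using le_iSup F x)
  have hG1 : ∀ x, G x / β ≤ 1 := fun x => ENNReal.div_le_of_le_mul (by simpa using le_iSup G x)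
  set c := α ^ a * β ^ b with hc
  have hc0 : c ≠ 0 := by
    simp [hc, hα0, hβ0, hαt, hβt]
  have hct : c ≠ ∞ := ENNReal.mul_ne_top (ENNReal.rpow_ne_top_of_nonneg ha.le hαt)
    (ENNReal.rpow_ne_top_of_nonneg hb.le hβt)
  have sup1 : ∀ (K : ℝ → ℝ≥0∞) (κ : ℝ≥0∞), κ = ⨆ x, K x → κ ≠ 0 → κ ≠ ∞ → (∀ x, K x / κ ≤ 1) →
      ∀ t : ℝ, t < 1 → ∃ x, t < (K x / κ).toReal := by
    intro K κ hκ h0 ht h1 t ht1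
    have : ENNReal.ofReal t * κ < ⨆ x, K x := by
      rw [← hκ]
      calc ENNReal.ofReal t * κ < 1 * κ :=
            ENNReal.mul_lt_mul_left h0 ht (by simpa using ht1)
        _ = κ := one_mul _
    obtain ⟨x, hx⟩ := lt_iSup_iff.1 this
    refine ⟨x, ?_⟩
    have : ENNReal.ofReal t < K x / κ := by
      rwa [ENNReal.lt_div_iff_mul_lt (Or.inl h0) (Or.inl ht)]
    rcases lt_or_ge t 0 with h | h
    · exact h.trans_le ENNReal.toReal_nonneg
    · exact (ENNReal.ofReal_lt_iff_lt_toReal h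
        (ne_top_of_le_ne_top ENNReal.one_ne_top (h1 x))).1 this
  have main := Real.lintegral_add_lintegral_le_of_sup_eq_one (f := fun x => (F x / α).toReal)
    (g := fun x => (G x / β).toReal) (h := fun x => (min (H x / c) 1).toReal)
    (hF.div_const _).ennreal_toReal (hG.div_const _).ennreal_toReal
    ((hH.div_const _).min measurable_const).ennreal_toReal (fun _ => ENNReal.toReal_nonneg)
    (fun _ => ENNReal.toReal_nonneg) (fun _ => ENNReal.toReal_nonneg)
    (fun x => ENNReal.toReal_le_of_le_ofReal zero_le_one (by simpa using hF1 x))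
    (fun x => ENNReal.toReal_le_of_le_ofReal zero_le_one (by simpa using hG1 x))
    (sup1 F α hα hα0 hαt hF1) (sup1 G β hβ hβ0 hβt hG1) ha hb (by
      intro x y t ht hx hy
      rw [← ENNReal.ofReal_lt_iff_lt_toReal ht.le
        (ne_top_of_le_ne_top ENNReal.one_ne_top (by first | exact hF1 x | exact hG1 y | simp))]
        at hx hy ⊢
      have e : H (a * x + b * y) / c ≥ (F x / α) ^ a * (G y / β) ^ b := by
        rw [ENNReal.div_rpow_of_nonneg _ _ ha.le, ENNReal.div_rpow_of_nonneg _ _ hb.le]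
        calc _ = (F x ^ a * G y ^ b) / c := by
              rw [hc, div_eq_mul_inv, div_eq_mul_inv, div_eq_mul_inv, ENNReal.mul_inv]
              · ring
              · left; simp [hα0, hαt]
              · left; exact ENNReal.rpow_ne_top_of_nonneg ha.le hαt
          _ ≤ _ := by gcongr; exact h x y
      refine lt_min (lt_of_lt_of_le ?_ e) (hx.trans_le (hF1 x))
      calc ENNReal.ofReal t = ENNReal.ofReal t ^ a * ENNReal.ofReal t ^ b := by
            rw [← ENNReal.rpow_add_of_nonneg _ _ ha.le hb.le, hab, ENNReal.rpow_one]
        _ < _ := ENNReal.mul_lt_mul (ENNReal.rpow_lt_rpow hx ha) (ENNReal.rpow_lt_rpow hy hb))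
  have r1 : ∀ (K : ℝ → ℝ≥0∞) (κ : ℝ≥0∞), Measurable K → (∀ x, K x / κ ≤ 1) →
      ∫⁻ x, ENNReal.ofReal ((K x / κ).toReal) = (∫⁻ x, K x) / κ := by
    intro K κ hK h1
    simp_rw [ENNReal.ofReal_toReal (ne_top_of_le_ne_top ENNReal.one_ne_top (h1 _)), div_eq_mul_inv]
    rw [lintegral_mul_const _ hK]
  rw [r1 F α hF hF1, r1 G β hG hG1] at main
  have h2 : ∫⁻ x, ENNReal.ofReal ((min (H x / c) 1).toReal) ≤ (∫⁻ x, H x) / c := by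
    simp_rw [div_eq_mul_inv]
    rw [← lintegral_mul_const _ hH]
    refine lintegral_mono fun x => ?_
    rw [ENNReal.ofReal_toReal (ne_top_of_le_ne_top ENNReal.one_ne_top (min_le_right _ _))]
    exact min_le_left _ _
  have h3 := (ENNReal.geom_mean_le_arith_mean2_weighted ha hb hab _ _).trans (main.trans h2)
  rw [ENNReal.div_rpow_of_nonneg _ _ ha.le, ENNReal.div_rpow_of_nonneg _ _ hb.le] at h3
  rw [ENNReal.le_div_iff_mul_le (Or.inl hc0) (Or.inl hct)] at h3
  refine le_trans (le_of_eq ?_) h3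
  have e1 : α ^ a ≠ 0 := by simp [hα0, hαt]
  have e2 : β ^ b ≠ 0 := by simp [hβ0, hβt]
  have e3 := ENNReal.rpow_ne_top_of_nonneg ha.le hαt
  have e4 := ENNReal.rpow_ne_top_of_nonneg hb.le hβt
  rw [hc]
  calc _ = ((∫⁻ x, F x) ^ a / α ^ a * α ^ a) * ((∫⁻ x, G x) ^ b / β ^ b * β ^ b) := by
        rw [ENNReal.div_mul_cancel e1 e3, ENNReal.div_mul_cancel e2 e4]
    _ = _ := by ring

/-- The one-dimensional **Prékopa-Leindler inequality**. -/
theorem Real.prekopa_leindler {F G H : ℝ → ℝ≥0∞} (hF : Measurable F) (hG : Measurable G)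
    (hH : Measurable H) {a b : ℝ} (ha : 0 < a) (hb : 0 < b) (hab : a + b = 1)
    (h : ∀ x y, F x ^ a * G y ^ b ≤ H (a * x + b * y)) :
    (∫⁻ x, F x) ^ a * (∫⁻ x, G x) ^ b ≤ ∫⁻ x, H x := by
  rcases eq_or_ne (∫⁻ x, F x) 0 with hF0 | hF0
  · simp [hF0, ha]
  rcases eq_or_ne (∫⁻ x, G x) 0 with hG0 | hG0
  · simp [hG0, hb]
  have lim : ∀ K : ℝ → ℝ≥0∞, Measurable K →
      Filter.Tendsto (fun n : ℕ => ∫⁻ x, min (K x) n) Filter.atTop (nhds (∫⁻ x, K x)) := by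
    intro K hK
    refine lintegral_tendsto_of_tendsto_of_monotone
      (fun n => (hK.min measurable_const).aemeasurable) ?_ ?_
    · refine Filter.Eventually.of_forall fun x m n hmn => ?_
      have : (m : ℝ≥0∞) ≤ n := by exact_mod_cast hmn
      exact min_le_min le_rfl this
    · refine Filter.Eventually.of_forall fun x => ?_
      have : Filter.Tendsto (fun n : ℕ => min (K x) (n : ℝ≥0∞)) Filter.atTop
          (nhds (min (K x) ⊤)) := tendsto_const_nhds.min ENNReal.tendsto_nat_nhds_top
      simpa using this
  have T := ENNReal.Tendsto.mul
    ((ENNReal.continuous_rpow_const (y := a)).tendsto _ |>.comp (lim F hF))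
    (Or.inl (by simp [hF0, ha, ha.le])) 
    ((ENNReal.continuous_rpow_const (y := b)).tendsto _ |>.comp (lim G hG))
    (Or.inl (by simp [hG0, hb, hb.le]))
  refine le_of_tendsto' T fun n => ?_
  refine Real.prekopa_leindler_of_bounded (hF.min measurable_const) (hG.min measurable_const) hH
    (ENNReal.natCast_ne_top n) (fun x => min_le_right _ _) (fun x => min_le_right _ _) ha hb hab ?_
  intro x y
  refine le_trans ?_ (h x y)
  gcongr <;> exact min_le_left _ _

/-- Log-concavity of a function with values in `[0, ∞]`. -/
def IsLogConcave {E : Type*} [AddCommGroup E] [Module ℝ E] (F : E → ℝ≥0∞) : Prop :=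
  ∀ (x y : E) (a b : ℝ), 0 < a → 0 < b → a + b = 1 → F x ^ a * F y ^ b ≤ F (a • x + b • y)

theorem IsLogConcave.comp_linearMap {E E' : Type*} [AddCommGroup E] [Module ℝ E] [AddCommGroup E']
    [Module ℝ E'] {F : E → ℝ≥0∞} (hF : IsLogConcave F) (f : E' →ₗ[ℝ] E) :
    IsLogConcave (fun x => F (f x)) := by
  intro x y a b ha hb hab
  simpa using hF (f x) (f y) a b ha hb hab

theorem IsLogConcave.mul {E : Type*} [AddCommGroup E] [Module ℝ E] {F G : E → ℝ≥0∞}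
    (hF : IsLogConcave F) (hG : IsLogConcave G) : IsLogConcave (fun x => F x * G x) := by
  intro x y a b ha hb hab
  simp only [ENNReal.mul_rpow_of_nonneg _ _ ha.le, ENNReal.mul_rpow_of_nonneg _ _ hb.le]
  calc _ = (F x ^ a * F y ^ b) * (G x ^ a * G y ^ b) := by ring
    _ ≤ _ := mul_le_mul' (hF x y a b ha hb hab) (hG x y a b ha hb hab)

theorem IsLogConcave.lintegral_real {E : Type*} [AddCommGroup E] [Module ℝ E]
    [MeasurableSpace E] {F : E × ℝ → ℝ≥0∞} (hF : IsLogConcave F) (hm : Measurable F) :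
    IsLogConcave (fun x => ∫⁻ t, F (x, t)) := by
  intro x y a b ha hb hab
  exact Real.prekopa_leindler (by fun_prop) (by fun_prop) (by fun_prop) ha hb hab
    fun s t => hF (x, s) (y, t) a b ha hb hab

/-- **Prékopa's theorem**: the marginals of a log-concave function are log-concave. -/
theorem IsLogConcave.lintegral_pi (n : ℕ) : ∀ {E : Type*} [AddCommGroup E] [Module ℝ E]
    [MeasurableSpace E] {F : E × (Fin n → ℝ) → ℝ≥0∞}, IsLogConcave F → Measurable F →
    IsLogConcave (fun x => ∫⁻ t, F (x, t)) := by
  induction n with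
  | zero =>
    intro E _ _ _ F hF hm x y a b ha hb hab
    have hv : (volume : Measure (Fin 0 → ℝ)) = Measure.dirac 0 := by
      rw [volume_pi, Measure.pi_of_empty _ 0]
    have := hF (x, 0) (y, 0) a b ha hb hab
    rw [hv]
    simp only [lintegral_dirac]
    simpa using this
  | succ n ih =>
    intro E _ _ _ F hF hm
    let L : (E × ℝ) × (Fin n → ℝ) →ₗ[ℝ] E × (Fin (n + 1) → ℝ) :=
      { toFun := fun p => (p.1.1, Fin.cons p.1.2 p.2)
        map_add' := by
          rintro ⟨⟨x, s⟩, t⟩ ⟨⟨x', s'⟩, t'⟩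
          refine Prod.ext rfl ?_
          funext i
          refine Fin.cases ?_ (fun j => ?_) i <;> simp
        map_smul' := by
          rintro c ⟨⟨x, s⟩, t⟩
          refine Prod.ext rfl ?_
          funext i
          refine Fin.cases ?_ (fun j => ?_) i <;> simp }
    have hL : Measurable L := by
      refine Measurable.prodMk (by fun_prop) ?_
      refine measurable_pi_lambda _ fun i => ?_
      refine Fin.cases ?_ (fun j => ?_) i
      · simp only [Fin.cons_zero]; fun_prop
      · simp only [Fin.cons_succ]; fun_prop
    have h1 := (ih (hF.comp_linearMap L) (hm.comp hL)).lintegral_real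
      (Measurable.lintegral_prod_right' (hm.comp hL))
    have e : (fun x => ∫⁻ t, F (x, t)) = fun x => ∫⁻ s : ℝ, ∫⁻ t, F (L ((x, s), t)) := by
      funext x
      have mp := (volume_preserving_piFinSuccAbove (fun _ : Fin (n + 1) => ℝ) 0).symm
      rw [← mp.lintegral_comp_emb (MeasurableEquiv.measurableEmbedding _)]
      have hcons : ∀ p : ℝ × (Fin n → ℝ),
          (x, (MeasurableEquiv.piFinSuccAbove (fun _ : Fin (n + 1) => ℝ) 0).symm p) =
            L ((x, p.1), p.2) := fun p =>
        Prod.ext rfl (Fin.insertNth_zero (α := fun _ => ℝ) p.1 p.2)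
      simp_rw [hcons]
      rw [Measure.volume_eq_prod, lintegral_prod]
      have : Measurable fun p : ℝ × (Fin n → ℝ) => F (L ((x, p.1), p.2)) :=
        (hm.comp hL).comp (by fun_prop)
      exact this.aemeasurable
    rw [e]
    exact h1

theorem IsLogConcave.lintegral_euclideanSpace {n : ℕ} {E : Type*} [AddCommGroup E] [Module ℝ E]
    [MeasurableSpace E] {F : E × EuclideanSpace ℝ (Fin n) → ℝ≥0∞} (hF : IsLogConcave F)
    (hm : Measurable F) : IsLogConcave (fun x => ∫⁻ t, F (x, t)) := by
  let L : E × (Fin n → ℝ) →ₗ[ℝ] E × EuclideanSpace ℝ (Fin n) :=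
    LinearMap.prodMap LinearMap.id (WithLp.linearEquiv 2 ℝ (Fin n → ℝ)).symm.toLinearMap
  have hL : Measurable L := by
    refine Measurable.prodMk measurable_fst ?_
    exact (PiLp.volume_preserving_toLp (Fin n)).measurable.comp measurable_snd
  have h := IsLogConcave.lintegral_pi n (hF.comp_linearMap L) (hm.comp hL)
  convert h using 2 with x
  rw [← (PiLp.volume_preserving_toLp (Fin n)).lintegral_comp_emb
    (MeasurableEquiv.toLp 2 (Fin n → ℝ)).measurableEmbedding]
  rfl

theorem lintegral_add_smul {E : Type*} [NormedAddCommGroup E] [NormedSpace ℝ E]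
    [MeasurableSpace E] [BorelSpace E] [FiniteDimensional ℝ E] (m : Measure E) [m.IsAddHaarMeasure]
    {f : E → ℝ≥0∞} (hf : Measurable f) (w : E) {c : ℝ} (hc : c ≠ 0) :
    ∫⁻ y, f (w + c • y) ∂m = ENNReal.ofReal |(c ^ Module.finrank ℝ E)⁻¹| * ∫⁻ y, f y ∂m := by
  have h := lintegral_map (μ := m) (f := fun y => f (w + y)) (g := fun y => c • y)
    (by fun_prop) (by fun_prop)
  rw [← h, Measure.map_addHaar_smul m hc, lintegral_smul_measure, smul_eq_mul,
    lintegral_add_left_eq_self f w]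

theorem exists_stdGaussian_eq_withDensity {E : Type*} [NormedAddCommGroup E]
    [InnerProductSpace ℝ E] [FiniteDimensional ℝ E] [MeasurableSpace E] [BorelSpace E] :
    ∃ Z : ℝ, 0 < Z ∧ stdGaussian E =
      (volume : Measure E).withDensity (fun x => ENNReal.ofReal (Z * Real.exp (-‖x‖ ^ 2 / 2))) := by
  set Z : ℝ := ((2 * Real.pi) ^ (Module.finrank ℝ E / 2 : ℝ))⁻¹ with hZ
  have hZ0 : 0 < Z := by positivity
  have hi0 : Integrable (fun x : E => Complex.exp (-(1 / 2 : ℂ) * ‖x‖ ^ 2 + 0 * inner ℝ 0 x)) :=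
    GaussianFourier.integrable_cexp_neg_mul_sq_norm_add (by norm_num) 0 0
  have hi : Integrable (fun x : E => Z * Real.exp (-‖x‖ ^ 2 / 2)) := by
    have := hi0.norm.const_mul Z
    refine this.congr (Filter.Eventually.of_forall fun x => ?_)
    simp only [Complex.norm_exp]
    congr 2
    simp [← Complex.ofReal_pow]
    ring
  refine ⟨Z, hZ0, ?_⟩
  have hfin : IsFiniteMeasure ((volume : Measure E).withDensity
      (fun x => ENNReal.ofReal (Z * Real.exp (-‖x‖ ^ 2 / 2)))) :=
    isFiniteMeasure_withDensity_ofReal hi.2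
  refine Measure.ext_of_charFun (funext fun t => ?_)
  rw [charFun_stdGaussian, charFun_apply,
    integral_withDensity_eq_integral_toReal_smul (by fun_prop) (by simp)]
  have h := GaussianFourier.integral_cexp_neg_mul_sq_norm_add (V := E) (b := 1 / 2) (by norm_num)
    Complex.I t
  have e : ∀ x : E, (ENNReal.ofReal (Z * Real.exp (-‖x‖ ^ 2 / 2))).toReal •
      Complex.exp ((inner ℝ x t : ℝ) * Complex.I) =
      (Z : ℂ) * Complex.exp (-(1 / 2) * ‖x‖ ^ 2 + Complex.I * inner ℝ t x) := by
    intro x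
    rw [ENNReal.toReal_ofReal (by positivity), Complex.real_smul, Complex.ofReal_mul, mul_assoc,
      Complex.ofReal_exp, ← Complex.exp_add, real_inner_comm]
    congr 2
    push_cast
    ring
  simp_rw [e]
  rw [integral_const_mul, h, hZ, ← mul_assoc]
  have : (((2 * Real.pi) ^ (Module.finrank ℝ E / 2 : ℝ))⁻¹ : ℝ) *
      ((Real.pi : ℂ) / (1 / 2)) ^ (Module.finrank ℝ E / 2 : ℂ) = 1 := by
    rw [show ((Real.pi : ℂ) / (1 / 2)) = ((2 * Real.pi : ℝ) : ℂ) by push_cast; ring,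
      show (Module.finrank ℝ E / 2 : ℂ) = ((Module.finrank ℝ E / 2 : ℝ) : ℂ) by push_cast; ring,
      ← Complex.ofReal_cpow (by positivity), ← Complex.ofReal_mul, inv_mul_cancel₀ (by positivity)]
    simp
  rw [this, one_mul]
  congr 1
  rw [Complex.I_sq]
  ring

/-- The density of the Ornstein-Uhlenbeck coupling with respect to Lebesgue measure. -/
theorem exists_ouCoupling_eq_withDensity (d : ℕ) {ε : ℝ} (hε : 0 < ε) :
    ∃ C : ℝ, 0 < C ∧ ouCoupling d ε = (volume : Measure (EuclideanSpace ℝ (Fin d) ×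
      EuclideanSpace ℝ (Fin d))).withDensity (fun p => ENNReal.ofReal (C * Real.exp
        (-(‖p.1‖ ^ 2 + ‖p.2‖ ^ 2 - 2 * Real.exp (-ε / 2) * inner ℝ p.1 p.2) /
          (2 * (1 - Real.exp (-ε)))))) := by
  obtain ⟨Z, hZ, hγ⟩ := exists_stdGaussian_eq_withDensity (E := EuclideanSpace ℝ (Fin d))
  set a := Real.exp (-ε / 2) with ha
  set c := Real.sqrt (1 - Real.exp (-ε)) with hc
  have h1 : 0 < 1 - Real.exp (-ε) := by simpa using hε
  have hc0 : 0 < c := Real.sqrt_pos.2 h1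
  have hc2 : 1 - Real.exp (-ε) = c ^ 2 := (Real.sq_sqrt h1.le).symm
  have hac : a ^ 2 = 1 - c ^ 2 := by
    rw [← hc2, ha, ← Real.exp_nat_mul]
    push_cast
    ring_nf
  rw [hc2]
  set G : EuclideanSpace ℝ (Fin d) → ℝ≥0∞ :=
    fun x => ENNReal.ofReal (Z * Real.exp (-‖x‖ ^ 2 / 2)) with hG
  have hGm : Measurable G := by fun_prop
  set q : ℝ := |(c ^ Module.finrank ℝ (EuclideanSpace ℝ (Fin d)))⁻¹| with hq
  have hq0 : 0 < q := by positivity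
  refine ⟨Z * Z * q, by positivity, ?_⟩
  refine Measure.ext_of_lintegral _ fun f hf => ?_
  rw [ouCoupling, hγ, lintegral_map hf (by fun_prop), prod_withDensity hGm hGm,
    lintegral_withDensity_eq_lintegral_mul _ (by fun_prop) (by fun_prop),
    lintegral_withDensity_eq_lintegral_mul _ (by fun_prop) (by fun_prop),
    Measure.volume_eq_prod, lintegral_prod _ (by fun_prop), lintegral_prod _ (by fun_prop)]
  refine lintegral_congr fun x => ?_
  simp only [Pi.mul_apply]
  have key := lintegral_add_smul (volume : Measure (EuclideanSpace ℝ (Fin d)))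
    (f := fun y => G x * G (c⁻¹ • (y - a • x)) * f (x, y)) (by fun_prop) (a • x) hc0.ne'
  have e : ∀ y, c⁻¹ • (a • x + c • y - a • x) = y := by
    intro y
    rw [add_sub_cancel_left, smul_smul, inv_mul_cancel₀ hc0.ne', one_smul]
  simp only [e] at key
  rw [key, ← lintegral_const_mul _ (by fun_prop)]
  refine lintegral_congr fun y => ?_
  rw [← mul_assoc]
  congr 1
  rw [hG, ← ENNReal.ofReal_mul (by positivity), ← ENNReal.ofReal_mul (by positivity)]
  congr 1
  have : Real.exp (-(‖x‖ ^ 2 + ‖y‖ ^ 2 - 2 * a * inner ℝ x y) / (2 * c ^ 2)) =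
      Real.exp (-‖x‖ ^ 2 / 2) * Real.exp (-‖c⁻¹ • (y - a • x)‖ ^ 2 / 2) := by
    rw [← Real.exp_add]
    congr 1
    rw [norm_smul, mul_pow, norm_sub_sq_real, norm_smul, inner_smul_right, real_inner_comm,
      mul_pow ‖a‖]
    simp only [Real.norm_eq_abs, sq_abs, hac, inv_pow]
    field_simp
    ring
  rw [this]
  ring

section ConvexOrder

variable {E : Type*} [NormedAddCommGroup E] [NormedSpace ℝ E]

theorem ConvexOn.exists_sub_mul_norm_le [FiniteDimensional ℝ E] {s : Set E} {f : E → ℝ}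
    (hf : ConvexOn ℝ s f) {x₀ : E} (hx₀ : x₀ ∈ interior s) :
    ∃ K : ℝ, 0 ≤ K ∧ ∀ y ∈ s, f x₀ - K * ‖y - x₀‖ ≤ f y := by
  obtain ⟨K, U, hU, hK⟩ := hf.locallyLipschitzOn_interior hx₀
  rw [isOpen_interior.nhdsWithin_eq hx₀] at hU
  obtain ⟨r, hr, hball⟩ := Metric.mem_nhds_iff.1 hU
  refine ⟨K, K.2, fun y hy => ?_⟩
  set n := ‖y - x₀‖ with hn
  have hn0 : 0 ≤ n := norm_nonneg _
  set t := r / (n + r + 1) with ht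
  have hden : 0 < n + r + 1 := by positivity
  have ht0 : 0 < t := by positivity
  have ht1 : t < 1 := by rw [ht, div_lt_one hden]; linarith
  have htn : t * n < r := by
    rw [ht, div_mul_eq_mul_div, div_lt_iff₀ hden]; nlinarith
  have hzeq : (1 - t) • x₀ + t • y - x₀ = t • (y - x₀) := by module
  have hz : (1 - t) • x₀ + t • y ∈ U := by
    apply hball
    rw [mem_ball_iff_norm, hzeq, norm_smul, Real.norm_of_nonneg ht0.le]
    exact htn
  have h1 := hf.2 (interior_subset hx₀) hy (by linarith : 0 ≤ 1 - t) ht0.le (by ring)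
  have h2 := hK.dist_le_mul _ hz x₀ (mem_of_mem_nhds hU)
  rw [dist_eq_norm, dist_eq_norm, hzeq, norm_smul, Real.norm_of_nonneg ht0.le, ← hn] at h2
  have h3 := (abs_le.1 h2).1
  simp only [smul_eq_mul] at h1
  have : t * (f x₀ - K * n) ≤ t * f y := by nlinarith
  exact le_of_mul_le_mul_left this ht0

/-- The largest `n`-Lipschitz function that is at most `F` on `s`. -/
noncomputable def lipschitzEnvelope (s : Set E) (F : E → ℝ) (n : ℝ) (x : E) : ℝ :=
  ⨅ y : s, (F y + n * ‖x - y‖)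

variable {s : Set E} {F : E → ℝ} {x₀ : E} {K n : ℝ}

theorem bddBelow_lipschitzEnvelope (hK0 : 0 ≤ K) (hK : ∀ y ∈ s, F x₀ - K * ‖y - x₀‖ ≤ F y)
    (hn : K ≤ n) (x : E) (y : s) : F x₀ - K * ‖x - x₀‖ ≤ F y + n * ‖x - y‖ := by
  have h1 := hK y y.2
  have h2 : ‖(y : E) - x₀‖ ≤ ‖x - y‖ + ‖x - x₀‖ := by
    have := norm_sub_le (x - x₀) (x - y)
    rw [sub_sub_sub_cancel_left] at this
    linarith
  nlinarith [norm_nonneg (x - y), mul_le_mul_of_nonneg_left h2 hK0,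
    mul_le_mul_of_nonneg_right hn (norm_nonneg (x - y))]

theorem bddBelow_range_lipschitzEnvelope (hK0 : 0 ≤ K)
    (hK : ∀ y ∈ s, F x₀ - K * ‖y - x₀‖ ≤ F y) (hn : K ≤ n) (x : E) :
    BddBelow (Set.range fun y : s => F y + n * ‖x - y‖) :=
  ⟨_, by rintro _ ⟨y, rfl⟩; exact bddBelow_lipschitzEnvelope hK0 hK hn x y⟩

theorem le_lipschitzEnvelope (hs : x₀ ∈ s) (hK0 : 0 ≤ K)
    (hK : ∀ y ∈ s, F x₀ - K * ‖y - x₀‖ ≤ F y) (hn : K ≤ n) (x : E) :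
    F x₀ - K * ‖x - x₀‖ ≤ lipschitzEnvelope s F n x := by
  have : Nonempty s := ⟨⟨x₀, hs⟩⟩
  exact le_ciInf fun y => bddBelow_lipschitzEnvelope hK0 hK hn x y

theorem lipschitzEnvelope_le (hK0 : 0 ≤ K) (hK : ∀ y ∈ s, F x₀ - K * ‖y - x₀‖ ≤ F y)
    (hn : K ≤ n) (x : E) {y : E} (hy : y ∈ s) :
    lipschitzEnvelope s F n x ≤ F y + n * ‖x - y‖ :=
  ciInf_le (bddBelow_range_lipschitzEnvelope hK0 hK hn x) ⟨y, hy⟩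

theorem lipschitzEnvelope_self (hs : x₀ ∈ s) (hK0 : 0 ≤ K)
    (hK : ∀ y ∈ s, F x₀ - K * ‖y - x₀‖ ≤ F y) (hn : K ≤ n) :
    lipschitzEnvelope s F n x₀ = F x₀ := by
  refine le_antisymm ?_ ?_
  · simpa using lipschitzEnvelope_le hK0 hK hn x₀ hs
  · simpa using le_lipschitzEnvelope hs hK0 hK hn x₀

theorem convexOn_lipschitzEnvelope (hF : ConvexOn ℝ s F) (hs : x₀ ∈ s) (hK0 : 0 ≤ K)
    (hK : ∀ y ∈ s, F x₀ - K * ‖y - x₀‖ ≤ F y) (hn : K ≤ n) :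
    ConvexOn ℝ Set.univ (lipschitzEnvelope s F n) := by
  have : Nonempty s := ⟨⟨x₀, hs⟩⟩
  refine ⟨convex_univ, fun x _ x' _ a b ha hb hab => ?_⟩
  refine le_of_forall_pos_le_add fun δ hδ => ?_
  obtain ⟨y, hy⟩ := exists_lt_of_ciInf_lt
    (lt_add_of_pos_right (lipschitzEnvelope s F n x) hδ)
  obtain ⟨y', hy'⟩ := exists_lt_of_ciInf_lt
    (lt_add_of_pos_right (lipschitzEnvelope s F n x') hδ)
  have h1 := lipschitzEnvelope_le hK0 hK hn (a • x + b • x') (hF.1 y.2 y'.2 ha hb hab)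
  have h2 := hF.2 y.2 y'.2 ha hb hab
  have h3 : ‖a • x + b • x' - (a • (y : E) + b • (y' : E))‖ ≤ a * ‖x - y‖ + b * ‖x' - y'‖ := by
    rw [show a • x + b • x' - (a • (y : E) + b • (y' : E)) = a • (x - y) + b • (x' - y') by module]
    refine (norm_add_le _ _).trans ?_
    rw [norm_smul, norm_smul, Real.norm_of_nonneg ha, Real.norm_of_nonneg hb]
  have h4 := mul_le_mul_of_nonneg_left h3 (hK0.trans hn)
  simp only [smul_eq_mul] at *
  nlinarith [mul_le_mul_of_nonneg_left hy.le ha, mul_le_mul_of_nonneg_left hy'.le hb]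

variable [MeasurableSpace E] [BorelSpace E]

theorem integrable_lipschitzEnvelope [FiniteDimensional ℝ E] (hF : ConvexOn ℝ s F) (hs : x₀ ∈ s)
    (hK0 : 0 ≤ K) (hK : ∀ y ∈ s, F x₀ - K * ‖y - x₀‖ ≤ F y) (hn : K ≤ n) (m : Measure E)
    [IsFiniteMeasure m] (hm : Integrable (fun x : E => x) m) :
    Integrable (lipschitzEnvelope s F n) m := by
  have hcont : Continuous (lipschitzEnvelope s F n) :=
    (convexOn_lipschitzEnvelope hF hs hK0 hK hn).locallyLipschitz.continuous
  have hi : Integrable (fun x => |F x₀| + n * ‖x - x₀‖) m :=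
    (integrable_const _).add ((hm.sub (integrable_const x₀)).norm.const_mul n)
  refine hi.mono' hcont.aestronglyMeasurable (Filter.Eventually.of_forall fun x => ?_)
  have h1 := lipschitzEnvelope_le hK0 hK hn x hs
  have h2 := le_lipschitzEnvelope hs hK0 hK hn x
  rw [Real.norm_eq_abs, abs_le]
  have := neg_abs_le (F x₀)
  have := le_abs_self (F x₀)
  constructor <;> nlinarith [mul_le_mul_of_nonneg_right hn (norm_nonneg (x - x₀))]

/-- A measure below `ν` in the convex order is carried by the closure of every convex set which
carries `ν`. -/
theorem ConvexOrderLE.ae_mem_closure [FiniteDimensional ℝ E] {η ν : Measure E}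
    [IsFiniteMeasure ν] (h : ConvexOrderLE η ν)
    (hs : Convex ℝ s) (hne : s.Nonempty) (hν : ∀ᵐ x ∂ν, x ∈ s) : ∀ᵐ x ∂η, x ∈ closure s := by
  obtain ⟨x₀, hx₀⟩ := hne
  have hF : ConvexOn ℝ s (fun _ : E => (0 : ℝ)) := convexOn_const 0 hs
  have hK : ∀ y ∈ s, (fun _ : E => (0 : ℝ)) x₀ - 0 * ‖y - x₀‖ ≤ (fun _ : E => (0 : ℝ)) y := by
    simp
  have hc := convexOn_lipschitzEnvelope hF hx₀ le_rfl hK zero_le_one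
  have h0 : ∀ x, 0 ≤ lipschitzEnvelope s (fun _ : E => (0 : ℝ)) 1 x := fun x => by
    simpa using le_lipschitzEnvelope (F := fun _ : E => (0 : ℝ)) hx₀ le_rfl hK zero_le_one x
  have hle := h.integral_le _ hc
    (integrable_lipschitzEnvelope hF hx₀ le_rfl hK zero_le_one ν h.integrable_right)
  have hν0 : ∫ x, lipschitzEnvelope s (fun _ : E => (0 : ℝ)) 1 x ∂ν = 0 := by
    refine integral_eq_zero_of_ae ?_
    filter_upwards [hν] with x hx
    refine le_antisymm ?_ (h0 x)
    simpa using lipschitzEnvelope_le (F := fun _ : E => (0 : ℝ)) le_rfl hK zero_le_one x hx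
  rw [hν0] at hle
  have hz := (integral_eq_zero_iff_of_nonneg h0 hle.1).1 (le_antisymm hle.2 (integral_nonneg h0))
  filter_upwards [hz] with x hx
  have : Nonempty s := ⟨⟨x₀, hx₀⟩⟩
  refine Metric.mem_closure_iff.2 fun δ hδ => ?_
  obtain ⟨y, hy⟩ := exists_lt_of_ciInf_lt (lt_of_eq_of_lt hx hδ)
  exact ⟨y, y.2, by simpa [dist_eq_norm] using hy⟩

theorem integrable_of_tendsto_of_integral_le {α : Type*} [MeasurableSpace α] {m : Measure α}
    {f : ℕ → α → ℝ} {g : α → ℝ} {c : ℝ} (hf : ∀ n, Integrable (f n) m)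
    (hmono : ∀ n, f 0 ≤ᵐ[m] f n)
    (hg : AEStronglyMeasurable g m)
    (hlim : ∀ᵐ x ∂m, Filter.Tendsto (fun n => f n x) Filter.atTop (nhds (g x)))
    (hc : ∀ n, ∫ x, f n x ∂m ≤ c) : Integrable g m ∧ ∫ x, g x ∂m ≤ c := by
  have hge : ∀ᵐ x ∂m, f 0 x ≤ g x := by
    filter_upwards [ae_all_iff.2 hmono, hlim] with x h1 h2
    exact ge_of_tendsto' h2 h1
  have hnn : 0 ≤ᵐ[m] fun x => g x - f 0 x := by
    filter_upwards [hge] with x hx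
    exact sub_nonneg.2 hx
  have hle : ∫⁻ x, ENNReal.ofReal (g x - f 0 x) ∂m ≤ ENNReal.ofReal (c - ∫ x, f 0 x ∂m) := by
    calc ∫⁻ x, ENNReal.ofReal (g x - f 0 x) ∂m
        = ∫⁻ x, Filter.liminf (fun n => ENNReal.ofReal (f n x - f 0 x)) Filter.atTop ∂m := by
          refine lintegral_congr_ae ?_
          filter_upwards [hlim] with x hx
          exact (((ENNReal.continuous_ofReal.tendsto _).comp
            (hx.sub_const (f 0 x))).liminf_eq).symm
      _ ≤ Filter.liminf (fun n => ∫⁻ x, ENNReal.ofReal (f n x - f 0 x) ∂m) Filter.atTop :=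
          lintegral_liminf_le' fun n => ((hf n).sub (hf 0)).aemeasurable.ennreal_ofReal
      _ ≤ _ := by
          refine Filter.liminf_le_of_le (by isBoundedDefault) fun b hb => ?_
          obtain ⟨n, hn⟩ := hb.exists
          refine hn.trans ?_
          rw [← ofReal_integral_eq_lintegral_ofReal (f := fun x => f n x - f 0 x)
            ((hf n).sub (hf 0)) ((hmono n).mono fun x hx => sub_nonneg.2 hx), integral_sub (hf n) (hf 0)]
          exact ENNReal.ofReal_le_ofReal (by linarith [hc n])
  have hm : AEStronglyMeasurable (fun x => g x - f 0 x) m := hg.sub (hf 0).1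
  have hint : Integrable (fun x => g x - f 0 x) m := by
    refine ⟨hm, ?_⟩
    rw [hasFiniteIntegral_iff_ofReal hnn]
    exact hle.trans_lt ENNReal.ofReal_lt_top
  have hgi : Integrable g m := by
    refine (hint.add (hf 0)).congr (Filter.Eventually.of_forall fun x => ?_)
    simp
  refine ⟨hgi, ?_⟩
  rw [← ofReal_integral_eq_lintegral_ofReal hint hnn, integral_sub hgi (hf 0)] at hle
  have := (ENNReal.ofReal_le_ofReal_iff (by linarith [hc 0])).1 hle
  linarith

/-- The convex order inequality for a convex function which is finite on a convex set only. -/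
theorem ConvexOrderLE.integral_le_of_convexOn [FiniteDimensional ℝ E] {η ν : Measure E}
    [IsFiniteMeasure η] [IsFiniteMeasure ν]
    (h : ConvexOrderLE η ν) (hF : ConvexOn ℝ s F) (hν : ∀ᵐ x ∂ν, x ∈ s)
    (hη : ∀ᵐ x ∂η, x ∈ interior s) (hne : (interior s).Nonempty) (hFν : Integrable F ν) :
    Integrable F η ∧ ∫ x, F x ∂η ≤ ∫ x, F x ∂ν := by
  obtain ⟨x₀, hx₀⟩ := hne
  have hx₀s := interior_subset hx₀
  obtain ⟨K, hK0, hK⟩ := hF.exists_sub_mul_norm_le hx₀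
  have hn : ∀ n : ℕ, K ≤ K + n := fun n => by simp
  refine integrable_of_tendsto_of_integral_le (f := fun n : ℕ => lipschitzEnvelope s F (K + n))
    (fun n => integrable_lipschitzEnvelope hF hx₀s hK0 hK (hn n) η h.integrable_left)
    (fun n => Filter.Eventually.of_forall fun x => ?_) ?_ ?_ (fun n => ?_)
  · refine ciInf_mono (bddBelow_range_lipschitzEnvelope hK0 hK (hn 0) x) fun y => ?_
    have : (0 : ℝ) ≤ n := n.cast_nonneg
    have := norm_nonneg (x - y)
    simp only [Nat.cast_zero, add_zero]
    gcongr
    exact hn n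
  · have hc := hF.continuousOn_interior.aestronglyMeasurable (μ := η)
      isOpen_interior.measurableSet
    rwa [Measure.restrict_eq_self_of_ae_mem hη] at hc
  · filter_upwards [hη] with x hx
    obtain ⟨K', hK'0, hK'⟩ := hF.exists_sub_mul_norm_le hx
    obtain ⟨N, hN⟩ := exists_nat_ge K'
    refine tendsto_const_nhds.congr' ?_
    filter_upwards [Filter.eventually_ge_atTop N] with n hn
    refine (lipschitzEnvelope_self (interior_subset hx) hK'0 hK' ?_).symm
    have : (N : ℝ) ≤ n := by exact_mod_cast hn
    linarith
  · have hi := integrable_lipschitzEnvelope hF hx₀s hK0 hK (hn n) ν h.integrable_right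
    refine (h.integral_le _ (convexOn_lipschitzEnvelope hF hx₀s hK0 hK (hn n)) hi).2.trans ?_
    refine integral_mono_ae hi hFν ?_
    filter_upwards [hν] with x hx
    simpa using lipschitzEnvelope_le hK0 hK (hn n) x hx

end ConvexOrder

theorem IsConvexExt.combo_le_coe {E : Type*} [AddCommGroup E] [Module ℝ E] {F : E → EReal}
    (hF : IsConvexExt F) {x y : E} (hx : F x ≠ ⊤) (hy : F y ≠ ⊤) {a b : ℝ} (ha : 0 < a)
    (hb : 0 < b) (hab : a + b = 1) :
    F (a • x + b • y) ≤ ((a * (F x).toReal + b * (F y).toReal : ℝ) : EReal) := by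
  have h := hF.le_combo x y a b ha hb hab
  rw [← EReal.coe_toReal hx (hF.ne_bot x), ← EReal.coe_toReal hy (hF.ne_bot y)] at h
  exact_mod_cast h

theorem IsConvexExt.convexOn_toReal {E : Type*} [AddCommGroup E] [Module ℝ E] {F : E → EReal}
    (hF : IsConvexExt F) : ConvexOn ℝ {x | F x ≠ ⊤} (fun x => (F x).toReal) := by
  have hne : ∀ x ∈ {x | F x ≠ ⊤}, ∀ y ∈ {x | F x ≠ ⊤}, ∀ a b : ℝ, 0 < a → 0 < b → a + b = 1 →
      a • x + b • y ∈ {x | F x ≠ ⊤} := fun x hx y hy a b ha hb hab =>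
    ne_top_of_le_ne_top (EReal.coe_ne_top _) (hF.combo_le_coe hx hy ha hb hab)
  have hc : Convex ℝ {x | F x ≠ ⊤} := convex_iff_forall_pos.2 fun x hx y hy a b ha hb hab =>
    hne x hx y hy a b ha hb hab
  refine convexOn_iff_forall_pos.2 ⟨hc, fun x hx y hy a b ha hb hab => ?_⟩
  have h := hF.combo_le_coe hx hy ha hb hab
  have h' := EReal.toReal_le_toReal h (hF.ne_bot _) (EReal.coe_ne_top _)
  rwa [EReal.toReal_coe] at h'

section

variable {E : Type*} [NormedAddCommGroup E] [InnerProductSpace ℝ E] [FiniteDimensional ℝ E]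
  [MeasurableSpace E] [BorelSpace E]

theorem stdGaussian_absolutelyContinuous : stdGaussian E ≪ (volume : Measure E) := by
  obtain ⟨Z, hZ, h⟩ := exists_stdGaussian_eq_withDensity (E := E)
  rw [h]
  exact withDensity_absolutelyContinuous _ _

theorem absolutelyContinuous_stdGaussian : (volume : Measure E) ≪ stdGaussian E := by
  obtain ⟨Z, hZ, h⟩ := exists_stdGaussian_eq_withDensity (E := E)
  rw [h]
  refine withDensity_absolutelyContinuous' (by fun_prop) (Filter.Eventually.of_forall fun x => ?_)
  simp only [ne_eq, ENNReal.ofReal_eq_zero, not_le]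
  positivity

/-- A convex set of full Lebesgue measure is the whole space. -/
theorem Convex.eq_univ_of_ae {s : Set E} (hs : Convex ℝ s) (h : ∀ᵐ x ∂(volume : Measure E), x ∈ s) :
    s = Set.univ := by
  refine Set.eq_univ_of_forall fun x => ?_
  have h1 : ∀ᵐ y ∂(volume : Measure E), x + y ∈ s :=
    (measurePreserving_add_left (volume : Measure E) x).quasiMeasurePreserving.ae h
  have h2 : ∀ᵐ y ∂(volume : Measure E), x - y ∈ s :=
    (Measure.measurePreserving_sub_left (volume : Measure E) x).quasiMeasurePreserving.ae h
  obtain ⟨y, hy1, hy2⟩ := (h1.and h2).exists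
  have := hs hy1 hy2 (by norm_num : (0 : ℝ) ≤ 1 / 2) (by norm_num : (0 : ℝ) ≤ 1 / 2) (by norm_num)
  convert this using 1
  module

/-- A convex function whose exponential is Gaussian-integrable is finite everywhere. -/
theorem IsConvexExt.exists_real_of_lintegral_exp_ne_top {V : E → EReal} (hV : IsConvexExt V)
    (h : ∫⁻ x, EReal.exp (V x) ∂(stdGaussian E) ≠ ∞) :
    ∃ v : E → ℝ, ConvexOn ℝ Set.univ v ∧ ∀ x, V x = v x := by
  have hc := hV.convexOn_toReal
  have hnull : NullMeasurableSet {x | V x ≠ ⊤}ᶜ (stdGaussian E) :=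
    ((hc.1.nullMeasurableSet volume).mono_ac stdGaussian_absolutelyContinuous).compl
  have h0 : stdGaussian E {x | V x ≠ ⊤}ᶜ = 0 := by
    by_contra hne
    refine h (top_le_iff.1 ?_)
    calc (∞ : ℝ≥0∞) = ∞ * stdGaussian E {x | V x ≠ ⊤}ᶜ := (ENNReal.top_mul hne).symm
      _ = ∫⁻ x, ({x | V x ≠ ⊤}ᶜ).indicator (fun _ => ∞) x ∂(stdGaussian E) :=
        (lintegral_indicator_const₀ hnull _).symm
      _ ≤ _ := by
        refine lintegral_mono fun x => ?_
        by_cases hx : V x = ⊤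
        · simp [hx]
        · simp [Set.indicator_of_notMem (show x ∉ {x | V x ≠ ⊤}ᶜ by simpa using hx)]
  have hu : {x | V x ≠ ⊤} = Set.univ :=
    hc.1.eq_univ_of_ae (absolutelyContinuous_stdGaussian.ae_le h0)
  refine ⟨fun x => (V x).toReal, hu ▸ hc, fun x => ?_⟩
  have : x ∈ {x | V x ≠ ⊤} := hu ▸ Set.mem_univ x
  exact (EReal.coe_toReal this (hV.ne_bot x)).symm

/-- Up to a null set, `exp (-W)` is the density of a convex function on an open convex set. -/
theorem IsConvexExt.exists_open_withDensity_eq {W : E → EReal} (hW : IsConvexExt W) :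
    ∃ (D : Set E) (w : E → ℝ), IsOpen D ∧ ConvexOn ℝ D w ∧
      (stdGaussian E).withDensity (fun x => EReal.exp (-W x)) =
        (stdGaussian E).withDensity (D.indicator fun x => ENNReal.ofReal (Real.exp (-w x))) := by
  have hc := hW.convexOn_toReal
  refine ⟨interior {x | W x ≠ ⊤}, fun x => (W x).toReal, isOpen_interior,
    hc.subset interior_subset hc.1.interior, withDensity_congr_ae ?_⟩
  have hfr : ∀ᵐ x ∂(stdGaussian E), x ∉ frontier {x | W x ≠ ⊤} :=
    stdGaussian_absolutelyContinuous.ae_le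
      (measure_eq_zero_iff_ae_notMem.1 (hc.1.addHaar_frontier volume))
  filter_upwards [hfr] with x hx
  by_cases hi : x ∈ interior {x | W x ≠ ⊤}
  · rw [Set.indicator_of_mem hi]
    have h1 : W x ≠ ⊤ := interior_subset hi
    conv_lhs => rw [← EReal.coe_toReal h1 (hW.ne_bot x)]
    rw [← EReal.coe_neg, EReal.exp_coe]
  · rw [Set.indicator_of_notMem hi]
    have : ¬ (W x ≠ ⊤) := fun h' => hx ⟨subset_closure h', hi⟩
    have h2 : W x = ⊤ := by simpa using this
    simp [h2]

/-- A convex function whose exponential is Gaussian-integrable grows at most quadratically. -/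
theorem ConvexOn.exists_le_sq_of_lintegral_exp {v : E → ℝ} (hv : ConvexOn ℝ Set.univ v)
    (h : ∫⁻ x, ENNReal.ofReal (Real.exp (v x)) ∂(stdGaussian E) ≠ ∞) :
    ∃ C : ℝ, ∀ x, v x ≤ C + ‖x‖ ^ 2 := by
  obtain ⟨Z, hZ, hγ⟩ := exists_stdGaussian_eq_withDensity (E := E)
  have hvm : Measurable v := hv.locallyLipschitz.continuous.measurable
  set B : Set E := Metric.ball 0 1
  set J : ℝ≥0∞ := ∫⁻ x, ENNReal.ofReal (Real.exp (v x)) ∂(stdGaussian E) with hJ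
  have hB0 : volume B ≠ 0 := (Metric.measure_ball_pos volume 0 one_pos).ne'
  have hBt : volume B ≠ ∞ := measure_ball_lt_top.ne
  have hJ' : J = ∫⁻ y, ENNReal.ofReal (Z * Real.exp (v y - ‖y‖ ^ 2 / 2)) := by
    rw [hJ, hγ, lintegral_withDensity_eq_lintegral_mul _ (by fun_prop) (by fun_prop)]
    refine lintegral_congr fun y => ?_
    rw [Pi.mul_apply, ← ENNReal.ofReal_mul (by positivity), mul_assoc, ← Real.exp_add]
    congr 3
    ring
  have key : ∀ x, ENNReal.ofReal (Z * Real.exp (v x - ‖x‖ ^ 2 - 1)) * volume B ≤ J + J := by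
    intro x
    set k : E → ℝ≥0∞ := fun y => ENNReal.ofReal (Z * Real.exp (v y - ‖y‖ ^ 2 / 2)) with hk
    have hkm : Measurable k := by fun_prop
    have e1 : ∫⁻ z, k (x + z) = J := by
      rw [hJ', lintegral_add_left_eq_self k x]
    have e2 : ∫⁻ z, k (x - z) = J := by
      rw [hJ', lintegral_sub_left_eq_self k x]
    calc _ = ∫⁻ _ in B, ENNReal.ofReal (Z * Real.exp (v x - ‖x‖ ^ 2 - 1)) := by
          rw [lintegral_const, Measure.restrict_apply_univ]
      _ ≤ ∫⁻ z in B, (k (x + z) + k (x - z)) := by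
          refine setLIntegral_mono' measurableSet_ball fun z hz => ?_
          have hz1 : ‖z‖ < 1 := by simpa [B] using hz
          rw [hk, ← ENNReal.ofReal_add (by positivity) (by positivity)]
          refine ENNReal.ofReal_le_ofReal ?_
          rw [← mul_add]
          refine mul_le_mul_of_nonneg_left ?_ hZ.le
          have h1 := hv.2 (Set.mem_univ (x + z)) (Set.mem_univ (x - z))
            (by norm_num : (0 : ℝ) ≤ 1 / 2) (by norm_num : (0 : ℝ) ≤ 1 / 2) (by norm_num)
          rw [show (1 / 2 : ℝ) • (x + z) + (1 / 2 : ℝ) • (x - z) = x by module] at h1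
          simp only [smul_eq_mul] at h1
          have hn : ∀ u : E, ‖u‖ ≤ ‖x‖ + ‖z‖ → ‖u‖ ^ 2 / 2 ≤ ‖x‖ ^ 2 + 1 := by
            intro u hu
            nlinarith [norm_nonneg u, norm_nonneg x, norm_nonneg z, sq_nonneg (‖x‖ - 1),
              sq_nonneg (‖x‖ - ‖z‖), mul_le_mul hu hu (norm_nonneg u) (by positivity)]
          have hp := hn _ (norm_add_le x z)
          have hm := hn _ (norm_sub_le x z)
          rcases le_total (v (x + z)) (v (x - z)) with h2 | h2
          · refine le_add_of_nonneg_of_le (by positivity) (Real.exp_le_exp.2 ?_)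
            linarith
          · refine le_add_of_le_of_nonneg (Real.exp_le_exp.2 ?_) (by positivity)
            linarith
      _ ≤ ∫⁻ z, (k (x + z) + k (x - z)) := setLIntegral_le_lintegral _ _
      _ = J + J := by
          rw [lintegral_add_left (by fun_prop), e1, e2]
  set T : ℝ := ((J + J) / volume B).toReal with hT
  have hTt : (J + J) / volume B ≠ ∞ := ENNReal.div_ne_top (by simp [h]) hB0
  refine ⟨Real.log ((T + 1) / Z) + 1, fun x => ?_⟩
  have h1 := key x
  rw [← ENNReal.le_div_iff_mul_le (Or.inl hB0) (Or.inl hBt)] at h1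
  have h2 := (ENNReal.ofReal_le_iff_le_toReal hTt).1 h1
  have hT0 : 0 ≤ T := ENNReal.toReal_nonneg
  have h3 : Real.exp (v x - ‖x‖ ^ 2 - 1) ≤ (T + 1) / Z := by
    rw [le_div_iff₀ hZ]
    linarith
  have h4 := (Real.le_log_iff_exp_le (by positivity)).2 h3
  linarith

end

/-- A sequence of uniformly Lipschitz functions vanishing at a fixed point has a pointwise convergent
subsequence. -/
theorem exists_subseq_tendsto_of_lipschitzWith {E : Type*} [PseudoMetricSpace E] [ProperSpace E]
    {L : NNReal} {f : ℕ → E → ℝ} (hf : ∀ n, LipschitzWith L (f n)) (x₀ : E)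
    (h0 : ∀ n, f n x₀ = 0) :
    ∃ (g : E → ℝ) (φ : ℕ → ℕ), StrictMono φ ∧ LipschitzWith L g ∧
      ∀ x, Filter.Tendsto (fun n => f (φ n) x) Filter.atTop (nhds (g x)) := by
  let S : Set C(E, ℝ) := {u | LipschitzWith L u ∧ u x₀ = 0}
  have hcomp : IsCompact (ContinuousMap.toFun '' S) := by
    have hK : IsCompact (Set.univ.pi fun x : E => Set.Icc (-(L * dist x x₀)) (L * dist x x₀)) :=
      isCompact_univ_pi fun x => isCompact_Icc
    have hcl : IsClosed {u : E → ℝ | (∀ x y, dist (u x) (u y) ≤ L * dist x y) ∧ u x₀ = 0} := by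
      have e : {u : E → ℝ | (∀ x y, dist (u x) (u y) ≤ L * dist x y) ∧ u x₀ = 0} =
          (⋂ x, ⋂ y, {u : E → ℝ | dist (u x) (u y) ≤ L * dist x y}) ∩ {u | u x₀ = 0} := by
        ext u
        simp
      rw [e]
      refine IsClosed.inter ?_ (isClosed_eq (continuous_apply _) continuous_const)
      exact isClosed_iInter fun x => isClosed_iInter fun y =>
        isClosed_le ((continuous_apply x).dist (continuous_apply y)) continuous_const
    convert hK.inter_right hcl using 1
    ext u
    constructor
    · rintro ⟨u, ⟨h1, h2⟩, rfl⟩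
      refine ⟨fun x _ => ?_, fun x y => h1.dist_le_mul x y, h2⟩
      have := h1.dist_le_mul x x₀
      rw [h2, Real.dist_eq, sub_zero] at this
      exact abs_le.1 this
    · rintro ⟨-, h1, h2⟩
      have hL : LipschitzWith L u := LipschitzWith.of_dist_le_mul h1
      exact ⟨⟨u, hL.continuous⟩, ⟨hL, h2⟩, rfl⟩
  have hS : IsCompact S := by
    refine ArzelaAscoli.isCompact_of_equicontinuous S hcomp ?_
    exact (LipschitzWith.uniformEquicontinuous (fun u : S => ((u : C(E, ℝ)) : E → ℝ)) L
      fun u => u.2.1).equicontinuous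
  obtain ⟨g, hg, φ, hφ, hlim⟩ := hS.isSeqCompact (x := fun n => ⟨f n, (hf n).continuous⟩)
    fun n => ⟨hf n, h0 n⟩
  refine ⟨g, φ, hφ, hg.1, fun x => ?_⟩
  exact ((continuous_eval_const x).tendsto g).comp hlim

section Schrodinger

variable {E : Type*} [NormedAddCommGroup E] [InnerProductSpace ℝ E] [FiniteDimensional ℝ E]
  [MeasurableSpace E] [BorelSpace E]

/-- The Laplace transform `y ↦ ∫ exp (b ⟨x, y⟩ - g x) μ(dx)`. -/
noncomputable def laplaceExp (b : ℝ) (μ : Measure E) (g : E → ℝ) (y : E) : ℝ≥0∞ :=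
  ∫⁻ x, ENNReal.ofReal (Real.exp (b * inner ℝ x y - g x)) ∂μ

/-- The weighted Laplace transform `x ↦ ∫ exp (b ⟨x, y⟩) k(y) ν(dy)`. -/
noncomputable def laplaceWeight (b : ℝ) (ν : Measure E) (k : E → ℝ≥0∞) (x : E) : ℝ≥0∞ :=
  ∫⁻ y, ENNReal.ofReal (Real.exp (b * inner ℝ x y)) * k y ∂ν

/-- The logarithm of the weighted Laplace transform, as a real function. -/
noncomputable def logLaplace (b : ℝ) (ν : Measure E) (k : E → ℝ≥0∞) (x : E) : ℝ :=
  Real.log (laplaceWeight b ν k x).toReal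

variable {b ρ : ℝ} {μ ν : Measure E} {k : E → ℝ≥0∞} {g : E → ℝ} {L : NNReal}

theorem measurable_laplaceExp [SFinite μ] (hg : Measurable g) : Measurable (laplaceExp b μ g) := by
  unfold laplaceExp
  exact Measurable.lintegral_prod_left' (f := fun p : E × E =>
    ENNReal.ofReal (Real.exp (b * inner ℝ p.1 p.2 - g p.1))) (by fun_prop)

theorem laplaceExp_sub_const (c : ℝ) (y : E) :
    laplaceExp b μ (fun x => g x - c) y = ENNReal.ofReal (Real.exp c) * laplaceExp b μ g y := by
  unfold laplaceExp
  rw [← lintegral_const_mul' _ _ ENNReal.ofReal_ne_top]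
  refine lintegral_congr fun x => ?_
  rw [← ENNReal.ofReal_mul (by positivity), ← Real.exp_add]
  congr 2
  ring

theorem laplaceWeight_ne_top [IsProbabilityMeasure ν] {M : ℝ≥0∞} (hM : M ≠ ∞) (hb : 0 ≤ b)
    (hρ : ∀ᵐ y ∂ν, ‖y‖ ≤ ρ) (hk : ∀ᵐ y ∂ν, k y ≤ M) (x : E) : laplaceWeight b ν k x ≠ ∞ := by
  have : laplaceWeight b ν k x ≤
      ∫⁻ _, ENNReal.ofReal (Real.exp (b * (‖x‖ * ρ))) * M ∂ν := by
    refine lintegral_mono_ae ?_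
    filter_upwards [hρ, hk] with y hy hk
    gcongr
    exact (real_inner_le_norm x y).trans (by gcongr)
  refine ne_top_of_le_ne_top ?_ this
  simp [ENNReal.mul_eq_top, hM]

theorem laplaceWeight_ne_zero [IsProbabilityMeasure ν] (hkm : Measurable k)
    (hk : ∀ᵐ y ∂ν, k y ≠ 0) (x : E) : laplaceWeight b ν k x ≠ 0 := by
  unfold laplaceWeight
  rw [ne_eq, lintegral_eq_zero_iff (by fun_prop)]
  intro h
  obtain ⟨y, hy, hy'⟩ := (h.and hk).exists
  simp only [Pi.zero_apply, mul_eq_zero, ENNReal.ofReal_eq_zero, hy', or_false] at hy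
  exact absurd hy (not_le.2 (Real.exp_pos _))

theorem logLaplace_lipschitzWith [IsProbabilityMeasure ν] {M : ℝ≥0∞} (hM : M ≠ ∞) (hb : 0 ≤ b)
    (hρ : ∀ᵐ y ∂ν, ‖y‖ ≤ ρ) (hL : b * ρ ≤ L) (hkm : Measurable k) (hk : ∀ᵐ y ∂ν, k y ≤ M)
    (hk0 : ∀ᵐ y ∂ν, k y ≠ 0) : LipschitzWith L (logLaplace b ν k) := by
  refine LipschitzWith.of_le_add_mul L fun x x' => ?_
  have h1 : laplaceWeight b ν k x ≤
      ENNReal.ofReal (Real.exp (L * dist x x')) * laplaceWeight b ν k x' := by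
    unfold laplaceWeight
    rw [← lintegral_const_mul' _ _ ENNReal.ofReal_ne_top]
    refine lintegral_mono_ae ?_
    filter_upwards [hρ] with y hy
    rw [← mul_assoc, ← ENNReal.ofReal_mul (by positivity), ← Real.exp_add]
    gcongr
    have e : inner ℝ x y = inner ℝ (x - x') y + inner ℝ x' y := by
      rw [← inner_add_left, sub_add_cancel]
    have h2 : inner ℝ (x - x') y ≤ dist x x' * ρ := by
      rw [dist_eq_norm]
      exact (real_inner_le_norm _ _).trans (by gcongr)
    rw [e, mul_add]
    have := mul_le_mul_of_nonneg_left h2 hb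
    have := mul_le_mul_of_nonneg_right hL (dist_nonneg (x := x) (y := x'))
    linarith
  have hx0 := laplaceWeight_ne_zero (b := b) hkm hk0 x
  have hx0' := laplaceWeight_ne_zero (b := b) hkm hk0 x'
  have hx1 := laplaceWeight_ne_top hM hb hρ hk x
  have hx1' := laplaceWeight_ne_top hM hb hρ hk x'
  have h3 := ENNReal.toReal_mono (ENNReal.mul_ne_top ENNReal.ofReal_ne_top hx1') h1
  rw [ENNReal.toReal_mul, ENNReal.toReal_ofReal (by positivity)] at h3
  have h4 := Real.log_le_log (ENNReal.toReal_pos hx0 hx1) h3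
  rw [Real.log_mul (by positivity) (ENNReal.toReal_pos hx0' hx1').ne', Real.log_exp] at h4
  unfold logLaplace
  linarith

theorem ofReal_exp_logLaplace {x : E} (h0 : laplaceWeight b ν k x ≠ 0) (h1 : laplaceWeight b ν k x ≠ ∞) :
    ENNReal.ofReal (Real.exp (logLaplace b ν k x)) = laplaceWeight b ν k x := by
  unfold logLaplace
  rw [Real.exp_log (ENNReal.toReal_pos h0 h1), ENNReal.ofReal_toReal h1]

theorem lintegral_laplaceExp_mul [SFinite μ] [SFinite ν] (hg : Measurable g) (hk : Measurable k) :
    ∫⁻ y, laplaceExp b μ g y * k y ∂ν =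
      ∫⁻ x, ENNReal.ofReal (Real.exp (-g x)) * laplaceWeight b ν k x ∂μ := by
  unfold laplaceExp laplaceWeight
  have e1 : ∀ y, (∫⁻ x, ENNReal.ofReal (Real.exp (b * inner ℝ x y - g x)) ∂μ) * k y =
      ∫⁻ x, ENNReal.ofReal (Real.exp (b * inner ℝ x y - g x)) * k y ∂μ := fun y =>
    (lintegral_mul_const _ (by fun_prop)).symm
  have e2 : ∀ x, ENNReal.ofReal (Real.exp (-g x)) *
      (∫⁻ y, ENNReal.ofReal (Real.exp (b * inner ℝ x y)) * k y ∂ν) =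
      ∫⁻ y, ENNReal.ofReal (Real.exp (b * inner ℝ x y - g x)) * k y ∂ν := fun x => by
    rw [← lintegral_const_mul _ (by fun_prop)]
    refine lintegral_congr fun y => ?_
    rw [← mul_assoc, ← ENNReal.ofReal_mul (by positivity), ← Real.exp_add]
    congr 3
    ring
  simp_rw [e1, e2]
  exact lintegral_lintegral_swap (by fun_prop)

/-- The uniform lower bound of the Laplace transforms of Lipschitz potentials. -/
theorem exists_le_laplaceExp [IsProbabilityMeasure μ] (hb : 0 ≤ b) (hL : b * ρ ≤ L) :
    ∃ M : ℝ, ∀ g : E → ℝ, LipschitzWith L g → g 0 = 0 → ∀ y : E, ‖y‖ ≤ ρ →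
      ENNReal.ofReal (Real.exp (-M)) ≤ laplaceExp b μ g y := by
  set m : ℝ≥0∞ := ∫⁻ x, ENNReal.ofReal (Real.exp (-(2 * L * ‖x‖))) ∂μ with hm
  have hm1 : m ≤ 1 := by
    calc m ≤ ∫⁻ _, 1 ∂μ := by
          refine lintegral_mono fun x => ?_
          rw [ENNReal.ofReal_le_one, Real.exp_le_one_iff, neg_nonpos]
          positivity
      _ = 1 := by simp
  have hmt : m ≠ ∞ := ne_top_of_le_ne_top ENNReal.one_ne_top hm1
  have hm0 : m ≠ 0 := by
    rw [hm, ne_eq, lintegral_eq_zero_iff (by fun_prop)]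
    intro h
    obtain ⟨x, hx⟩ := h.exists
    simp only [Pi.zero_apply, ENNReal.ofReal_eq_zero] at hx
    exact absurd hx (not_le.2 (Real.exp_pos _))
  refine ⟨-Real.log m.toReal, fun g hg h0 y hy => ?_⟩
  rw [neg_neg, Real.exp_log (ENNReal.toReal_pos hm0 hmt), ENNReal.ofReal_toReal hmt]
  refine lintegral_mono fun x => ?_
  gcongr
  have h1 := hg.dist_le_mul x 0
  rw [h0, Real.dist_eq, sub_zero, dist_zero_right] at h1
  have h2 := neg_le_of_abs_le (abs_real_inner_le_norm x y)
  have h3 : ‖x‖ * ‖y‖ ≤ ‖x‖ * ρ := by gcongr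
  have h4 := le_abs_self (g x)
  nlinarith [mul_le_mul_of_nonneg_left h2 hb, mul_le_mul_of_nonneg_left h3 hb,
    mul_le_mul_of_nonneg_right hL (norm_nonneg x)]

/-- Potentials whose Laplace transform has an integrable logarithm. -/
def HasIntegrableLog (b : ℝ) (μ ν : Measure E) (g : E → ℝ) : Prop :=
  (∀ᵐ y ∂ν, laplaceExp b μ g y ≠ ∞) ∧
    Integrable (fun y => Real.log (laplaceExp b μ g y).toReal) ν

theorem integrable_of_lipschitzWith [IsFiniteMeasure μ] (hμ : Integrable (fun x : E => x) μ)
    (hg : LipschitzWith L g) : Integrable g μ := by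
  have hi : Integrable (fun x : E => |g 0| + L * ‖x‖) μ :=
    (integrable_const _).add (hμ.norm.const_mul _)
  refine hi.mono' hg.continuous.aestronglyMeasurable (Filter.Eventually.of_forall fun x => ?_)
  have h1 := hg.dist_le_mul x 0
  rw [Real.dist_eq, dist_zero_right] at h1
  rw [Real.norm_eq_abs]
  have := abs_add_le (g x - g 0) (g 0)
  rw [sub_add_cancel] at this
  linarith

/-- If `∫ exp (-g) k̂ dμ = 1`, with `k̂` the weighted Laplace transform of `k`, then the
Laplace transform of `g` has an integrable logarithm. -/
theorem HasIntegrableLog.of_lintegral_mul_le_one [IsProbabilityMeasure μ] [IsProbabilityMeasure ν]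
    (hgm : Measurable g) {m : ℝ} (hm : ∀ᵐ y ∂ν, ENNReal.ofReal (Real.exp (-m)) ≤ laplaceExp b μ g y)
    (hkm : Measurable k) (hk0 : ∀ᵐ y ∂ν, k y ≠ 0) (hk1 : ∀ᵐ y ∂ν, k y ≠ ∞)
    (hki : Integrable (fun y => Real.log (k y).toReal) ν)
    (h1 : ∫⁻ y, laplaceExp b μ g y * k y ∂ν ≤ 1) :
    HasIntegrableLog b μ ν g ∧
      ∫ y, Real.log (laplaceExp b μ g y).toReal ∂ν ≤ -∫ y, Real.log (k y).toReal ∂ν := by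
  have hum := measurable_laplaceExp (b := b) (μ := μ) hgm
  have hprod : Measurable fun y => laplaceExp b μ g y * k y := hum.mul hkm
  have hfin := ae_lt_top hprod (ne_top_of_le_ne_top ENNReal.one_ne_top h1)
  have hut : ∀ᵐ y ∂ν, laplaceExp b μ g y ≠ ∞ := by
    filter_upwards [hfin, hk0] with y h2 h3 h4
    rw [h4, ENNReal.top_mul h3] at h2
    exact lt_irrefl _ h2
  have hpi : Integrable (fun y => (laplaceExp b μ g y * k y).toReal) ν :=
    integrable_toReal_of_lintegral_ne_top hprod.aemeasurable
      (ne_top_of_le_ne_top ENNReal.one_ne_top h1)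
  have hpint : ∫ y, (laplaceExp b μ g y * k y).toReal ∂ν ≤ 1 := by
    rw [integral_toReal hprod.aemeasurable hfin]
    exact ENNReal.toReal_le_of_le_ofReal zero_le_one (by simpa using h1)
  have hpos : ∀ᵐ y ∂ν, Real.exp (-m) ≤ (laplaceExp b μ g y).toReal := by
    filter_upwards [hm, hut] with y h2 h3
    exact (ENNReal.ofReal_le_iff_le_toReal h3).1 h2
  have hupper : ∀ᵐ y ∂ν, Real.log (laplaceExp b μ g y).toReal ≤
      (laplaceExp b μ g y * k y).toReal - 1 - Real.log (k y).toReal := by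
    filter_upwards [hpos, hk0, hk1] with y h2 h3 h4
    have hu : 0 < (laplaceExp b μ g y).toReal := (Real.exp_pos _).trans_le h2
    have hk : 0 < (k y).toReal := ENNReal.toReal_pos h3 h4
    have := Real.log_le_sub_one_of_pos (mul_pos hu hk)
    rw [Real.log_mul hu.ne' hk.ne'] at this
    rw [ENNReal.toReal_mul]
    linarith
  have hlower : ∀ᵐ y ∂ν, -m ≤ Real.log (laplaceExp b μ g y).toReal := by
    filter_upwards [hpos] with y h2
    exact (Real.le_log_iff_exp_le ((Real.exp_pos _).trans_le h2)).2 h2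
  have hRi : Integrable (fun y => (laplaceExp b μ g y * k y).toReal - 1 -
      Real.log (k y).toReal) ν := (hpi.sub (integrable_const 1)).sub hki
  have hint : Integrable (fun y => Real.log (laplaceExp b μ g y).toReal) ν :=
    integrable_of_le_of_le (Real.measurable_log.comp hum.ennreal_toReal).aestronglyMeasurable
      hlower hupper (integrable_const _) hRi
  refine ⟨⟨hut, hint⟩, ?_⟩
  calc _ ≤ ∫ y, ((laplaceExp b μ g y * k y).toReal - 1 - Real.log (k y).toReal) ∂ν :=
        integral_mono_ae hint hRi hupper
    _ = ∫ y, (laplaceExp b μ g y * k y).toReal ∂ν - 1 - ∫ y, Real.log (k y).toReal ∂ν := by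
        rw [integral_sub (f := fun y => (laplaceExp b μ g y * k y).toReal - 1)
          (hpi.sub (integrable_const 1)) hki, integral_sub hpi (integrable_const 1)]
        simp
    _ ≤ _ := by linarith

end Schrodinger

section Schrodinger

variable {E : Type*} [NormedAddCommGroup E] [InnerProductSpace ℝ E] [FiniteDimensional ℝ E]
  [MeasurableSpace E] [BorelSpace E]
variable {b ρ : ℝ} {μ ν : Measure E} {g : E → ℝ} {L : NNReal}

/-- `log t + M`, truncated below at zero. -/
noncomputable def shiftedLog (M : ℝ) (t : ℝ≥0∞) : ℝ≥0∞ :=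
  (ENNReal.log (t * ENNReal.ofReal (Real.exp M))).toENNReal

theorem shiftedLog_monotone (M : ℝ) : Monotone (shiftedLog M) := fun s t h =>
  EReal.toENNReal_le_toENNReal (ENNReal.log_monotone (by gcongr))

theorem shiftedLog_continuous (M : ℝ) : Continuous (shiftedLog M) :=
  EReal.continuous_toENNReal.comp
    (ENNReal.continuous_log.comp (ENNReal.continuous_mul_const ENNReal.ofReal_ne_top))

theorem shiftedLog_top (M : ℝ) : shiftedLog M ∞ = ∞ := by
  have : ENNReal.ofReal (Real.exp M) ≠ 0 := by simp [Real.exp_pos]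
  simp [shiftedLog, ENNReal.top_mul this]

theorem shiftedLog_of_ne_top {M : ℝ} {t : ℝ≥0∞} (h0 : t ≠ 0) (ht : t ≠ ∞) :
    shiftedLog M t = ENNReal.ofReal (Real.log t.toReal + M) := by
  have h1 : t * ENNReal.ofReal (Real.exp M) ≠ 0 :=
    mul_ne_zero h0 (by simp [Real.exp_pos])
  have h2 : t * ENNReal.ofReal (Real.exp M) ≠ ∞ := ENNReal.mul_ne_top ht ENNReal.ofReal_ne_top
  rw [shiftedLog, ENNReal.log_pos_real h1 h2, EReal.toENNReal_of_ne_top (EReal.coe_ne_top _),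
    EReal.toReal_coe, ENNReal.toReal_mul, ENNReal.toReal_ofReal (Real.exp_pos _).le,
    Real.log_mul (ENNReal.toReal_pos h0 ht).ne' (Real.exp_pos _).ne', Real.log_exp]

/-- The dual Schrödinger functional, shifted so as to be nonnegative. -/
noncomputable def schrodingerFunctional (b : ℝ) (μ ν : Measure E) (C M : ℝ) (g : E → ℝ) : ℝ≥0∞ :=
  ENNReal.ofReal (∫ x, g x ∂μ + C) + ∫⁻ y, shiftedLog M (laplaceExp b μ g y) ∂ν

theorem schrodingerFunctional_eq {C M : ℝ} [IsProbabilityMeasure ν] (hC : 0 ≤ ∫ x, g x ∂μ + C)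
    (hM : ∀ᵐ y ∂ν, ENNReal.ofReal (Real.exp (-M)) ≤ laplaceExp b μ g y)
    (h : HasIntegrableLog b μ ν g) :
    schrodingerFunctional b μ ν C M g =
      ENNReal.ofReal (∫ x, g x ∂μ + C + (∫ y, Real.log (laplaceExp b μ g y).toReal ∂ν + M)) ∧
      0 ≤ ∫ y, Real.log (laplaceExp b μ g y).toReal ∂ν + M := by
  have hpos : ∀ᵐ y ∂ν, laplaceExp b μ g y ≠ 0 := hM.mono fun y hy h0 => by
    rw [h0] at hy
    simp only [nonpos_iff_eq_zero, ENNReal.ofReal_eq_zero] at hy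
    exact absurd hy (not_le.2 (Real.exp_pos _))
  have hnn : 0 ≤ᵐ[ν] fun y => Real.log (laplaceExp b μ g y).toReal + M := by
    filter_upwards [hM, h.1] with y h1 h2
    have h3 := (ENNReal.ofReal_le_iff_le_toReal h2).1 h1
    have h4 := (Real.le_log_iff_exp_le ((Real.exp_pos _).trans_le h3)).2 h3
    simp only [Pi.zero_apply]
    linarith
  have hint : Integrable (fun y => Real.log (laplaceExp b μ g y).toReal + M) ν :=
    h.2.add (integrable_const M)
  have e : ∫ y, (Real.log (laplaceExp b μ g y).toReal + M) ∂ν =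
      ∫ y, Real.log (laplaceExp b μ g y).toReal ∂ν + M := by
    rw [integral_add h.2 (integrable_const M)]
    simp
  have h0 : 0 ≤ ∫ y, Real.log (laplaceExp b μ g y).toReal ∂ν + M := e ▸ integral_nonneg_of_ae hnn
  refine ⟨?_, h0⟩
  rw [schrodingerFunctional, ENNReal.ofReal_add hC h0, ← e,
    ofReal_integral_eq_lintegral_ofReal hint hnn]
  congr 1
  refine lintegral_congr_ae ?_
  filter_upwards [hpos, h.1] with y h1 h2
  exact shiftedLog_of_ne_top h1 h2

theorem HasIntegrableLog.of_schrodingerFunctional_ne_top {C M : ℝ} [SFinite μ]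
    [IsProbabilityMeasure ν] (hg : Measurable g)
    (hM : ∀ᵐ y ∂ν, ENNReal.ofReal (Real.exp (-M)) ≤ laplaceExp b μ g y)
    (h : schrodingerFunctional b μ ν C M g ≠ ∞) : HasIntegrableLog b μ ν g := by
  have hum := measurable_laplaceExp (b := b) (μ := μ) hg
  have hpos : ∀ᵐ y ∂ν, laplaceExp b μ g y ≠ 0 := hM.mono fun y hy h0 => by
    rw [h0] at hy
    simp only [nonpos_iff_eq_zero, ENNReal.ofReal_eq_zero] at hy
    exact absurd hy (not_le.2 (Real.exp_pos _))
  have hlt : ∫⁻ y, shiftedLog M (laplaceExp b μ g y) ∂ν ≠ ∞ := fun h' => h (by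
    rw [schrodingerFunctional, h', add_top])
  have hm : Measurable fun y => shiftedLog M (laplaceExp b μ g y) :=
    (shiftedLog_continuous M).measurable.comp hum
  have hfin : ∀ᵐ y ∂ν, laplaceExp b μ g y ≠ ∞ := by
    filter_upwards [ae_lt_top hm hlt] with y hy h'
    rw [h', shiftedLog_top] at hy
    exact lt_irrefl _ hy
  refine ⟨hfin, ?_⟩
  have hi := (integrable_toReal_of_lintegral_ne_top hm.aemeasurable hlt).sub (integrable_const M)
  refine hi.congr ?_
  filter_upwards [hM, hpos, hfin] with y h1 h2 h3
  have h4 := (ENNReal.ofReal_le_iff_le_toReal h3).1 h1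
  have h5 := (Real.le_log_iff_exp_le ((Real.exp_pos _).trans_le h4)).2 h4
  simp only [Pi.sub_apply]
  rw [shiftedLog_of_ne_top h2 h3, ENNReal.toReal_ofReal (by linarith)]
  ring

theorem laplaceExp_le_liminf {f : ℕ → E → ℝ} (hf : ∀ n, Measurable (f n))
    (hlim : ∀ x, Filter.Tendsto (fun n => f n x) Filter.atTop (nhds (g x))) (y : E) :
    laplaceExp b μ g y ≤ Filter.liminf (fun n => laplaceExp b μ (f n) y) Filter.atTop := by
  refine le_trans (le_of_eq ?_) (lintegral_liminf_le fun n => ?_)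
  · refine lintegral_congr fun x => ?_
    have : Filter.Tendsto (fun n => ENNReal.ofReal (Real.exp (b * inner ℝ x y - f n x)))
        Filter.atTop (nhds (ENNReal.ofReal (Real.exp (b * inner ℝ x y - g x)))) :=
      (ENNReal.continuous_ofReal.tendsto _).comp
        ((Real.continuous_exp.tendsto _).comp ((hlim x).const_sub _))
    exact this.liminf_eq.symm
  · have := hf n
    fun_prop

/-- The dual Schrödinger functional attains its minimum on a class of Lipschitz potentials which is
closed under pointwise limits. -/
theorem exists_min_schrodinger [IsProbabilityMeasure μ] [IsProbabilityMeasure ν]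
    (hμ : Integrable (fun x : E => x) μ) (hb : 0 ≤ b) (hL : b * ρ ≤ L)
    (hρ : ∀ᵐ y ∂ν, ‖y‖ ≤ ρ) (𝒞 : Set (E → ℝ)) (hLip : ∀ g ∈ 𝒞, LipschitzWith L g)
    (h0 : ∀ g ∈ 𝒞, g 0 = 0)
    (hcl : ∀ (f : ℕ → E → ℝ) (g : E → ℝ), (∀ n, f n ∈ 𝒞) → LipschitzWith L g →
      (∀ x, Filter.Tendsto (fun n => f n x) Filter.atTop (nhds (g x))) → g ∈ 𝒞)
    (hne : ∃ g ∈ 𝒞, HasIntegrableLog b μ ν g) :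
    ∃ g ∈ 𝒞, HasIntegrableLog b μ ν g ∧ ∀ g' ∈ 𝒞, HasIntegrableLog b μ ν g' →
      ∫ x, g x ∂μ + ∫ y, Real.log (laplaceExp b μ g y).toReal ∂ν ≤
        ∫ x, g' x ∂μ + ∫ y, Real.log (laplaceExp b μ g' y).toReal ∂ν := by
  obtain ⟨M, hM⟩ := exists_le_laplaceExp (μ := μ) (L := L) hb hL
  set C : ℝ := L * ∫ x, ‖x‖ ∂μ with hCdef
  have hMae : ∀ g ∈ 𝒞, ∀ᵐ y ∂ν, ENNReal.ofReal (Real.exp (-M)) ≤ laplaceExp b μ g y :=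
    fun g hg => hρ.mono fun y hy => hM g (hLip g hg) (h0 g hg) y hy
  have hbd : ∀ g ∈ 𝒞, ∀ x, |g x| ≤ L * ‖x‖ := fun g hg x => by
    have := (hLip g hg).dist_le_mul x 0
    rwa [h0 g hg, Real.dist_eq, sub_zero, dist_zero_right] at this
  have hC : ∀ g ∈ 𝒞, 0 ≤ ∫ x, g x ∂μ + C := fun g hg => by
    have h1 : ∫ x, -(L * ‖x‖) ∂μ ≤ ∫ x, g x ∂μ :=
      integral_mono (hμ.norm.const_mul _).neg (integrable_of_lipschitzWith hμ (hLip g hg))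
        fun x => neg_le_of_abs_le (hbd g hg x)
    rw [integral_neg, integral_const_mul] at h1
    linarith
  set Φ := schrodingerFunctional b μ ν C M with hΦ
  obtain ⟨g₀, hg₀, hfin₀⟩ := hne
  obtain ⟨v, -, hv, hmem⟩ := exists_seq_tendsto_sInf (S := Φ '' 𝒞) ⟨_, g₀, hg₀, rfl⟩ (OrderBot.bddBelow _)
  choose f hf hfv using hmem
  obtain ⟨g, φ, hφ, hgL, hlim⟩ := exists_subseq_tendsto_of_lipschitzWith
    (fun n => hLip _ (hf n)) 0 fun n => h0 _ (hf n)
  have hg : g ∈ 𝒞 := hcl _ g (fun n => hf (φ n)) hgL hlim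
  have hI : Filter.Tendsto (fun n => Φ (f (φ n))) Filter.atTop (nhds (sInf (Φ '' 𝒞))) := by
    simp_rw [hfv]
    exact hv.comp hφ.tendsto_atTop
  have hA : Filter.Tendsto (fun n => ENNReal.ofReal (∫ x, f (φ n) x ∂μ + C)) Filter.atTop
      (nhds (ENNReal.ofReal (∫ x, g x ∂μ + C))) := by
    refine (ENNReal.continuous_ofReal.tendsto _).comp (Filter.Tendsto.add_const _ ?_)
    exact tendsto_integral_of_dominated_convergence (fun x => L * ‖x‖)
      (fun n => (hLip _ (hf _)).continuous.aestronglyMeasurable) (hμ.norm.const_mul _)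
      (fun n => Filter.Eventually.of_forall fun x => hbd _ (hf _) x)
      (Filter.Eventually.of_forall hlim)
  have hB : ∫⁻ y, shiftedLog M (laplaceExp b μ g y) ∂ν ≤
      Filter.liminf (fun n => ∫⁻ y, shiftedLog M (laplaceExp b μ (f (φ n)) y) ∂ν) Filter.atTop := by
    refine le_trans (lintegral_mono fun y => ?_) (lintegral_liminf_le fun n =>
      (shiftedLog_continuous M).measurable.comp
        (measurable_laplaceExp (hLip _ (hf _)).continuous.measurable))
    refine (shiftedLog_monotone M (laplaceExp_le_liminf
      (fun n => (hLip _ (hf (φ n))).continuous.measurable) hlim y)).trans (le_of_eq ?_)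
    exact (shiftedLog_monotone M).map_liminf_of_continuousAt _
      (shiftedLog_continuous M).continuousAt
  have hmin : Φ g ≤ sInf (Φ '' 𝒞) := by
    set A := ENNReal.ofReal (∫ x, g x ∂μ + C) with hAdef
    have hsub : Filter.Tendsto (fun n => ∫⁻ y, shiftedLog M (laplaceExp b μ (f (φ n)) y) ∂ν)
        Filter.atTop (nhds (sInf (Φ '' 𝒞) - A)) := by
      refine (ENNReal.Tendsto.sub hI hA (Or.inr ENNReal.ofReal_ne_top)).congr fun n => ?_
      rw [hΦ, schrodingerFunctional, ENNReal.add_sub_cancel_left ENNReal.ofReal_ne_top]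
    rw [hsub.liminf_eq] at hB
    have hAI : A ≤ sInf (Φ '' 𝒞) := le_of_tendsto_of_tendsto' hA hI fun n => by
      rw [hΦ, schrodingerFunctional]
      exact le_self_add
    calc Φ g ≤ A + (sInf (Φ '' 𝒞) - A) := add_le_add_right hB _
      _ = _ := add_tsub_cancel_of_le hAI
  have hle : ∀ g' ∈ 𝒞, Φ g ≤ Φ g' := fun g' hg' => hmin.trans (sInf_le ⟨g', hg', rfl⟩)
  have hgfin : HasIntegrableLog b μ ν g := by
    refine HasIntegrableLog.of_schrodingerFunctional_ne_top hgL.continuous.measurable (hMae g hg)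
      (ne_top_of_le_ne_top ?_ (hle g₀ hg₀))
    rw [hΦ, (schrodingerFunctional_eq (hC _ hg₀) (hMae _ hg₀) hfin₀).1]
    exact ENNReal.ofReal_ne_top
  refine ⟨g, hg, hgfin, fun g' hg' hfin' => ?_⟩
  have h1 := hle g' hg'
  obtain ⟨e1, n1⟩ := schrodingerFunctional_eq (hC _ hg) (hMae _ hg) hgfin
  obtain ⟨e2, n2⟩ := schrodingerFunctional_eq (hC _ hg') (hMae _ hg') hfin'
  rw [hΦ, e1, e2, ENNReal.ofReal_le_ofReal_iff (add_nonneg (hC _ hg') n2)] at h1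
  linarith

theorem ENNReal.ofReal_exp_ne_zero (t : ℝ) : ENNReal.ofReal (Real.exp t) ≠ 0 := by
  simp [Real.exp_pos]

theorem HasIntegrableLog.logLaplace_sub [IsProbabilityMeasure μ] [IsProbabilityMeasure ν]
    (hb : 0 ≤ b) (hL : b * ρ ≤ L) (hρ : ∀ᵐ y ∂ν, ‖y‖ ≤ ρ) {k : E → ℝ≥0∞} (hkm : Measurable k)
    {B : ℝ≥0∞} (hB : B ≠ ∞) (hkB : ∀ᵐ y ∂ν, k y ≤ B) (hk0 : ∀ᵐ y ∂ν, k y ≠ 0)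
    (hki : Integrable (fun y => Real.log (k y).toReal) ν) :
    HasIntegrableLog b μ ν (fun x => logLaplace b ν k x - logLaplace b ν k 0) ∧
      ∫ y, Real.log (laplaceExp b μ (fun x => logLaplace b ν k x - logLaplace b ν k 0) y).toReal ∂ν
        ≤ logLaplace b ν k 0 - ∫ y, Real.log (k y).toReal ∂ν := by
  obtain ⟨M, hM⟩ := exists_le_laplaceExp (μ := μ) (L := L) hb hL
  have hw0 := fun x => laplaceWeight_ne_zero (b := b) hkm hk0 x
  have hw1 := fun x => laplaceWeight_ne_top hB hb hρ hkB x
  have hGL : LipschitzWith L (logLaplace b ν k) :=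
    logLaplace_lipschitzWith hB hb hρ hL hkm hkB hk0
  set G := logLaplace b ν k with hG
  have hGm := hGL.continuous.measurable
  have hone : ∀ x, ENNReal.ofReal (Real.exp (-G x)) * laplaceWeight b ν k x = 1 := fun x => by
    rw [← ofReal_exp_logLaplace (hw0 x) (hw1 x), ← ENNReal.ofReal_mul (Real.exp_pos _).le,
      ← Real.exp_add, neg_add_cancel, Real.exp_zero, ENNReal.ofReal_one]
  have hint1 : ∫⁻ y, laplaceExp b μ G y * k y ∂ν = 1 := by
    rw [lintegral_laplaceExp_mul hGm hkm]
    simp [hone]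
  have hMG : ∀ᵐ y ∂ν, ENNReal.ofReal (Real.exp (-(M + G 0))) ≤ laplaceExp b μ G y := by
    filter_upwards [hρ] with y hy
    have h1 := hM (fun x => G x - G 0)
      (LipschitzWith.of_dist_le_mul fun x y => by simpa using hGL.dist_le_mul x y)
      (sub_self _) y hy
    rw [laplaceExp_sub_const] at h1
    calc ENNReal.ofReal (Real.exp (-(M + G 0)))
        = ENNReal.ofReal (Real.exp (-G 0)) * ENNReal.ofReal (Real.exp (-M)) := by
          rw [← ENNReal.ofReal_mul (Real.exp_pos _).le, ← Real.exp_add]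
          congr 2
          ring
      _ ≤ ENNReal.ofReal (Real.exp (-G 0)) * (ENNReal.ofReal (Real.exp (G 0)) *
          laplaceExp b μ G y) := by gcongr
      _ = laplaceExp b μ G y := by
          rw [← mul_assoc, ← ENNReal.ofReal_mul (Real.exp_pos _).le, ← Real.exp_add,
            neg_add_cancel, Real.exp_zero, ENNReal.ofReal_one, one_mul]
  obtain ⟨hGfin, hGle⟩ := HasIntegrableLog.of_lintegral_mul_le_one hGm hMG hkm hk0
    (hkB.mono fun y hy => ne_top_of_le_ne_top hB hy) hki hint1.le
  have hlog1 : (fun y => Real.log (laplaceExp b μ (fun x => G x - G 0) y).toReal) =ᵐ[ν]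
      fun y => G 0 + Real.log (laplaceExp b μ G y).toReal := by
    filter_upwards [hMG, hGfin.1] with y h1 h2
    have h3 : laplaceExp b μ G y ≠ 0 := fun h =>
      ENNReal.ofReal_exp_ne_zero _ (nonpos_iff_eq_zero.1 (h ▸ h1))
    rw [laplaceExp_sub_const, ENNReal.toReal_mul, ENNReal.toReal_ofReal (Real.exp_pos _).le,
      Real.log_mul (Real.exp_pos _).ne' (ENNReal.toReal_pos h3 h2).ne', Real.log_exp]
  refine ⟨⟨?_, ((integrable_const (G 0)).add hGfin.2).congr hlog1.symm⟩, ?_⟩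
  · filter_upwards [hGfin.1] with y hy
    rw [laplaceExp_sub_const]
    exact ENNReal.mul_ne_top ENNReal.ofReal_ne_top hy
  · rw [integral_congr_ae hlog1, integral_add (integrable_const _) hGfin.2]
    simp only [integral_const, probReal_univ, one_smul]
    linarith

/-- Existence of a solution of the Schrödinger system in a class of potentials which is stable
under the Sinkhorn iteration. -/
theorem exists_schrodinger_potential [IsProbabilityMeasure μ] [IsProbabilityMeasure ν]
    (hμ : Integrable (fun x : E => x) μ) (hb : 0 ≤ b) (hL : b * ρ ≤ L)
    (hρ : ∀ᵐ y ∂ν, ‖y‖ ≤ ρ) (𝒞 : Set (E → ℝ)) (hLip : ∀ g ∈ 𝒞, LipschitzWith L g)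
    (h0 : ∀ g ∈ 𝒞, g 0 = 0)
    (hcl : ∀ (f : ℕ → E → ℝ) (g : E → ℝ), (∀ n, f n ∈ 𝒞) → LipschitzWith L g →
      (∀ x, Filter.Tendsto (fun n => f n x) Filter.atTop (nhds (g x))) → g ∈ 𝒞)
    (hne : ∃ g ∈ 𝒞, HasIntegrableLog b μ ν g)
    (hst : ∀ g ∈ 𝒞, HasIntegrableLog b μ ν g → (fun x =>
      logLaplace b ν (fun y => (laplaceExp b μ g y)⁻¹) x -
        logLaplace b ν (fun y => (laplaceExp b μ g y)⁻¹) 0) ∈ 𝒞) :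
    ∃ g ∈ 𝒞, HasIntegrableLog b μ ν g ∧
      ∀ᵐ x ∂μ, ENNReal.ofReal (Real.exp (-g x)) *
        laplaceWeight b ν (fun y => (laplaceExp b μ g y)⁻¹) x = 1 := by
  obtain ⟨g, hg, hgfin, hmin⟩ := exists_min_schrodinger hμ hb hL hρ 𝒞 hLip h0 hcl hne
  refine ⟨g, hg, hgfin, ?_⟩
  obtain ⟨M, hM⟩ := exists_le_laplaceExp (μ := μ) (L := L) hb hL
  have hgm := (hLip g hg).continuous.measurable
  set k : E → ℝ≥0∞ := fun y => (laplaceExp b μ g y)⁻¹ with hk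
  have hum : Measurable (laplaceExp b μ g) := measurable_laplaceExp hgm
  have hkm : Measurable k := hum.inv
  have hMg : ∀ᵐ y ∂ν, ENNReal.ofReal (Real.exp (-M)) ≤ laplaceExp b μ g y :=
    hρ.mono fun y hy => hM g (hLip g hg) (h0 g hg) y hy
  have hupos : ∀ᵐ y ∂ν, laplaceExp b μ g y ≠ 0 := hMg.mono fun y hy h =>
    ENNReal.ofReal_exp_ne_zero (-M) (nonpos_iff_eq_zero.1 (h ▸ hy))
  have hk0 : ∀ᵐ y ∂ν, k y ≠ 0 := hgfin.1.mono fun y hy => ENNReal.inv_ne_zero.2 hy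
  have hk1 : ∀ᵐ y ∂ν, k y ≠ ∞ := hupos.mono fun y hy => ENNReal.inv_ne_top.2 hy
  have hkM : ∀ᵐ y ∂ν, k y ≤ (ENNReal.ofReal (Real.exp (-M)))⁻¹ := hMg.mono fun y hy =>
    ENNReal.inv_le_inv.2 hy
  have hMt : (ENNReal.ofReal (Real.exp (-M)))⁻¹ ≠ ∞ := ENNReal.inv_ne_top.2 (ENNReal.ofReal_exp_ne_zero _)
  have hw0 := fun x => laplaceWeight_ne_zero (b := b) hkm hk0 x
  have hw1 := fun x => laplaceWeight_ne_top hMt hb hρ hkM x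
  set G := logLaplace b ν k with hG
  have hGL : LipschitzWith L G := logLaplace_lipschitzWith hMt hb hρ hL hkm hkM hk0
  have hGm := hGL.continuous.measurable
  have hg1 : (fun x => G x - G 0) ∈ 𝒞 := hst g hg hgfin
  have hlogk : ∀ y, Real.log (k y).toReal = -Real.log (laplaceExp b μ g y).toReal := fun y => by
    rw [hk, ENNReal.toReal_inv, Real.log_inv]
  have hone : ∀ x, ENNReal.ofReal (Real.exp (-G x)) * laplaceWeight b ν k x = 1 := fun x => by
    rw [← ofReal_exp_logLaplace (hw0 x) (hw1 x), ← ENNReal.ofReal_mul (Real.exp_pos _).le,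
      ← Real.exp_add, neg_add_cancel, Real.exp_zero, ENNReal.ofReal_one]
  have hki : Integrable (fun y => Real.log (k y).toReal) ν := by
    simp_rw [hlogk]
    exact hgfin.2.neg
  obtain ⟨hg1fin, hGle⟩ := HasIntegrableLog.logLaplace_sub (μ := μ) hb hL hρ hkm hMt hkM hk0 hki
  have hGi := integrable_of_lipschitzWith hμ hGL
  have hgi := integrable_of_lipschitzWith hμ (hLip g hg)
  have hineq := hmin _ hg1 hg1fin
  rw [integral_sub hGi (integrable_const _)] at hineq
  simp only [integral_const, probReal_univ, one_smul, hlogk, integral_neg] at hineq hGle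
  have hexpint : ∫⁻ x, ENNReal.ofReal (Real.exp (G x - g x)) ∂μ = 1 := by
    have h1 := lintegral_laplaceExp_mul (b := b) (μ := μ) (ν := ν) hgm hkm
    have h2 : ∫⁻ y, laplaceExp b μ g y * k y ∂ν = 1 := by
      have : (fun y => laplaceExp b μ g y * k y) =ᵐ[ν] fun _ => 1 := by
        filter_upwards [hupos, hgfin.1] with y h3 h4
        exact ENNReal.mul_inv_cancel h3 h4
      rw [lintegral_congr_ae this]
      simp
    rw [← h2, h1]
    refine lintegral_congr fun x => ?_
    rw [← ofReal_exp_logLaplace (hw0 x) (hw1 x), ← ENNReal.ofReal_mul (Real.exp_pos _).le,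
      ← Real.exp_add]
    congr 2
    ring
  have hei : Integrable (fun x => Real.exp (G x - g x)) μ := by
    refine ⟨(by fun_prop), ?_⟩
    rw [hasFiniteIntegral_iff_ofReal (Filter.Eventually.of_forall fun x => (Real.exp_pos _).le),
      hexpint]
    exact ENNReal.one_lt_top
  have heint : ∫ x, Real.exp (G x - g x) ∂μ = 1 := by
    rw [integral_eq_lintegral_of_nonneg_ae
      (Filter.Eventually.of_forall fun x => (Real.exp_pos _).le) (by fun_prop), hexpint]
    simp
  have hnn : ∀ x, 0 ≤ Real.exp (G x - g x) - 1 - (G x - g x) := fun x => by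
    linarith [Real.add_one_le_exp (G x - g x)]
  have hdi : Integrable (fun x => Real.exp (G x - g x) - 1 - (G x - g x)) μ :=
    (hei.sub (integrable_const 1)).sub (hGi.sub hgi)
  have hzero : ∫ x, (Real.exp (G x - g x) - 1 - (G x - g x)) ∂μ = 0 := by
    refine le_antisymm ?_ (integral_nonneg hnn)
    rw [integral_sub (f := fun x => Real.exp (G x - g x) - 1) (hei.sub (integrable_const 1))
      (g := fun x => G x - g x) (hGi.sub hgi), integral_sub hei (integrable_const 1), heint, integral_sub hGi hgi]
    simp only [integral_const, probReal_univ, one_smul]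
    linarith
  have hae := (integral_eq_zero_iff_of_nonneg hnn hdi).1 hzero
  filter_upwards [hae] with x hx
  have hxG : G x = g x := by
    by_contra hne
    have := Real.add_one_lt_exp (sub_ne_zero.2 hne)
    simp only [Pi.zero_apply] at hx
    linarith
  rw [← hxG]
  exact hone x

end Schrodinger

theorem ConvexOn.isLogConcave_ofReal_exp_neg {E : Type*} [AddCommGroup E] [Module ℝ E] {s : Set E}
    {f : E → ℝ} (hf : ConvexOn ℝ s f) :
    IsLogConcave (s.indicator fun x => ENNReal.ofReal (Real.exp (-f x))) := by
  intro x y a b ha hb hab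
  by_cases hx : x ∈ s
  swap
  · simp [Set.indicator_of_notMem hx, ha]
  by_cases hy : y ∈ s
  swap
  · simp [Set.indicator_of_notMem hy, hb]
  rw [Set.indicator_of_mem hx, Set.indicator_of_mem hy,
    Set.indicator_of_mem (hf.1 hx hy ha.le hb.le hab),
    ENNReal.ofReal_rpow_of_pos (Real.exp_pos _), ENNReal.ofReal_rpow_of_pos (Real.exp_pos _),
    ← Real.exp_mul, ← Real.exp_mul, ← ENNReal.ofReal_mul (Real.exp_pos _).le, ← Real.exp_add]
  have := hf.2 hx hy ha.le hb.le hab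
  simp only [smul_eq_mul] at this
  gcongr
  linarith

theorem IsLogConcave.convex_ne_zero {E : Type*} [AddCommGroup E] [Module ℝ E] {F : E → ℝ≥0∞}
    (hF : IsLogConcave F) : Convex ℝ {x | F x ≠ 0} := by
  refine convex_iff_forall_pos.2 fun x hx y hy a b ha hb hab h => ?_
  have h1 := hF x y a b ha hb hab
  rw [h, nonpos_iff_eq_zero, mul_eq_zero, ENNReal.rpow_eq_zero_iff, ENNReal.rpow_eq_zero_iff] at h1
  rcases h1 with (h1 | h1) | (h1 | h1)
  · exact hx h1.1
  · linarith [h1.2]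
  · exact hy h1.1
  · linarith [h1.2]

theorem IsLogConcave.concaveOn_log {E : Type*} [AddCommGroup E] [Module ℝ E] {F : E → ℝ≥0∞}
    (hF : IsLogConcave F) (ht : ∀ x, F x ≠ ∞) :
    ConcaveOn ℝ {x | F x ≠ 0} (fun x => Real.log (F x).toReal) := by
  refine concaveOn_iff_forall_pos.2 ⟨hF.convex_ne_zero, fun x hx y hy a b ha hb hab => ?_⟩
  have h1 := ENNReal.toReal_mono (ht _) (hF x y a b ha hb hab)
  have hx' := ENNReal.toReal_pos hx (ht x)
  have hy' := ENNReal.toReal_pos hy (ht y)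
  rw [ENNReal.toReal_mul, ← ENNReal.toReal_rpow, ← ENNReal.toReal_rpow] at h1
  have h2 := Real.log_le_log (by positivity) h1
  rw [Real.log_mul (by positivity) (by positivity), Real.log_rpow hx', Real.log_rpow hy'] at h2
  simpa using h2

theorem IsLogConcave.const_mul {E : Type*} [AddCommGroup E] [Module ℝ E] {F : E → ℝ≥0∞}
    (hF : IsLogConcave F) (c : ℝ≥0∞) : IsLogConcave (fun x => c * F x) := by
  refine IsLogConcave.mul (fun x y a b ha hb hab => ?_) hF
  rw [← ENNReal.rpow_add_of_nonneg _ _ ha.le hb.le, hab, ENNReal.rpow_one]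

theorem convexOn_norm_sq_comp {E E' : Type*} [AddCommGroup E] [Module ℝ E]
    [NormedAddCommGroup E'] [InnerProductSpace ℝ E'] (f : E →ₗ[ℝ] E') {q : ℝ} (hq : 0 ≤ q) :
    ConvexOn ℝ Set.univ (fun x => q * ‖f x‖ ^ 2) := by
  have h1 : ConvexOn ℝ Set.univ (fun x : E' => ‖x‖ ^ 2) :=
    (convexOn_norm convex_univ).pow (fun x _ => norm_nonneg x) 2
  exact (h1.comp_linearMap f).smul hq

section Potentials

variable {d : ℕ}

local notation "𝔼" => EuclideanSpace ℝ (Fin d)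

variable {μ ν : Measure (EuclideanSpace ℝ (Fin d))} {a c : ℝ}

theorem laplaceWeight_eq_lintegral_gaussian (hc : 0 < c) (hac : a ^ 2 + c ^ 2 = 1)
    {f k : 𝔼 → ℝ≥0∞} (hf : Measurable f) (hk : Measurable k)
    (hν : ν = (stdGaussian 𝔼).withDensity f) :
    ∃ Z : ℝ≥0∞, ∀ x : 𝔼,
      ENNReal.ofReal (Real.exp (-(a ^ 2 / c ^ 2 / 2 * ‖x‖ ^ 2))) *
        laplaceWeight (a / c ^ 2) ν k x =
      Z * ∫⁻ y, ENNReal.ofReal (Real.exp (-(1 / (2 * c ^ 2) * ‖y - a • x‖ ^ 2))) *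
        (f y * ENNReal.ofReal (Real.exp (a ^ 2 / c ^ 2 / 2 * ‖y‖ ^ 2)) * k y) := by
  obtain ⟨Z, hZ, hγ⟩ := exists_stdGaussian_eq_withDensity (E := EuclideanSpace ℝ (Fin d))
  refine ⟨ENNReal.ofReal Z, fun x => ?_⟩
  unfold laplaceWeight
  rw [hν, hγ, lintegral_withDensity_eq_lintegral_mul _ hf (by fun_prop),
    lintegral_withDensity_eq_lintegral_mul _ (by fun_prop) (by fun_prop),
    ← lintegral_const_mul _ (by fun_prop), ← lintegral_const_mul _ (by fun_prop)]
  refine lintegral_congr fun y => ?_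
  simp only [Pi.mul_apply]
  have e : ENNReal.ofReal (Real.exp (-(a ^ 2 / c ^ 2 / 2 * ‖x‖ ^ 2))) *
      ENNReal.ofReal (Z * Real.exp (-‖y‖ ^ 2 / 2)) *
      ENNReal.ofReal (Real.exp (a / c ^ 2 * inner ℝ x y)) =
      ENNReal.ofReal Z * ENNReal.ofReal (Real.exp (-(1 / (2 * c ^ 2) * ‖y - a • x‖ ^ 2))) *
      ENNReal.ofReal (Real.exp (a ^ 2 / c ^ 2 / 2 * ‖y‖ ^ 2)) := by
    rw [ENNReal.ofReal_mul hZ.le]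
    rw [show ∀ p q r s : ℝ≥0∞, p * (q * r) * s = q * (p * r * s) from fun p q r s => by ring,
      mul_assoc (ENNReal.ofReal Z)]
    congr 1
    rw [← ENNReal.ofReal_mul (by positivity), ← ENNReal.ofReal_mul (by positivity),
      ← ENNReal.ofReal_mul (by positivity), ← Real.exp_add, ← Real.exp_add, ← Real.exp_add]
    congr 2
    rw [norm_sub_sq_real, norm_smul, inner_smul_right, real_inner_comm, mul_pow]
    simp only [Real.norm_eq_abs, sq_abs]
    have h1 : a ^ 2 = 1 - c ^ 2 := by linarith
    field_simp
    rw [h1]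
    ring
  calc _ = (ENNReal.ofReal (Real.exp (-(a ^ 2 / c ^ 2 / 2 * ‖x‖ ^ 2))) *
      ENNReal.ofReal (Z * Real.exp (-‖y‖ ^ 2 / 2)) *
      ENNReal.ofReal (Real.exp (a / c ^ 2 * inner ℝ x y))) * (f y * k y) := by ring
    _ = _ := by rw [e]; ring

/-- Prékopa's theorem for the logarithmic Laplace transform. -/
theorem concaveOn_logLaplace_sub (hc : 0 < c) (hac : a ^ 2 + c ^ 2 = 1)
    {f k : 𝔼 → ℝ≥0∞} (hf : Measurable f) (hk : Measurable k)
    (hν : ν = (stdGaussian 𝔼).withDensity f)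
    (hΨ : IsLogConcave fun y =>
      f y * ENNReal.ofReal (Real.exp (a ^ 2 / c ^ 2 / 2 * ‖y‖ ^ 2)) * k y)
    (h0 : ∀ x, laplaceWeight (a / c ^ 2) ν k x ≠ 0)
    (h1 : ∀ x, laplaceWeight (a / c ^ 2) ν k x ≠ ∞) :
    ConcaveOn ℝ Set.univ
      (fun x => logLaplace (a / c ^ 2) ν k x - a ^ 2 / c ^ 2 / 2 * ‖x‖ ^ 2) := by
  obtain ⟨Z, hZ⟩ := laplaceWeight_eq_lintegral_gaussian hc hac hf hk hν
  set J : 𝔼 → ℝ≥0∞ := fun x => ENNReal.ofReal (Real.exp (-(a ^ 2 / c ^ 2 / 2 * ‖x‖ ^ 2))) *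
        laplaceWeight (a / c ^ 2) ν k x with hJ
  have hJLC : IsLogConcave J := by
    have e : J = fun x => Z * ∫⁻ y, ENNReal.ofReal
        (Real.exp (-(1 / (2 * c ^ 2) * ‖y - a • x‖ ^ 2))) *
        (f y * ENNReal.ofReal (Real.exp (a ^ 2 / c ^ 2 / 2 * ‖y‖ ^ 2)) * k y) := funext hZ
    rw [e]
    refine IsLogConcave.const_mul ?_ Z
    refine IsLogConcave.lintegral_euclideanSpace (F := fun p : 𝔼 × 𝔼 => ENNReal.ofReal
        (Real.exp (-(1 / (2 * c ^ 2) * ‖p.2 - a • p.1‖ ^ 2))) *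
        (f p.2 * ENNReal.ofReal (Real.exp (a ^ 2 / c ^ 2 / 2 * ‖p.2‖ ^ 2)) * k p.2)) ?_
        (by fun_prop)
    refine IsLogConcave.mul ?_ (hΨ.comp_linearMap (LinearMap.snd ℝ 𝔼 𝔼))
    have := (convexOn_norm_sq_comp (LinearMap.snd ℝ 𝔼 𝔼 - a • LinearMap.fst ℝ 𝔼 𝔼)
      (by positivity : 0 ≤ 1 / (2 * c ^ 2))).isLogConcave_ofReal_exp_neg
    simpa using this
  have hJ0 : ∀ x, J x ≠ 0 := fun x => mul_ne_zero (ENNReal.ofReal_exp_ne_zero _) (h0 x)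
  have hJ1 : ∀ x, J x ≠ ∞ := fun x => ENNReal.mul_ne_top ENNReal.ofReal_ne_top (h1 x)
  have h := hJLC.concaveOn_log hJ1
  have hu : {x | J x ≠ 0} = Set.univ := Set.eq_univ_of_forall hJ0
  rw [hu] at h
  refine h.congr fun x _ => ?_
  simp only [hJ]
  rw [ENNReal.toReal_mul, ENNReal.toReal_ofReal (Real.exp_pos _).le,
    Real.log_mul (Real.exp_pos _).ne' (ENNReal.toReal_pos (h0 x) (h1 x)).ne', Real.log_exp]
  unfold logLaplace
  ring

/-- Hölder's inequality: the Gaussian smoothing of a log-convex function is log-convex. -/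
theorem isLogConcave_inv_laplaceExp (hc : 0 < c) (hac : a ^ 2 + c ^ 2 = 1) {v g : 𝔼 → ℝ}
    (hv : ConvexOn ℝ Set.univ v)
    (hμ : μ = (stdGaussian 𝔼).withDensity fun x => ENNReal.ofReal (Real.exp (v x)))
    (hg : ConcaveOn ℝ Set.univ (fun x => g x - a ^ 2 / c ^ 2 / 2 * ‖x‖ ^ 2))
    (h0 : ∀ y, laplaceExp (a / c ^ 2) μ g y ≠ 0) :
    IsLogConcave fun y => ENNReal.ofReal (Real.exp (a ^ 2 / c ^ 2 / 2 * ‖y‖ ^ 2)) *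
      (laplaceExp (a / c ^ 2) μ g y)⁻¹ := by
  obtain ⟨Z, hZ, hγ⟩ := exists_stdGaussian_eq_withDensity (E := EuclideanSpace ℝ (Fin d))
  set φ : 𝔼 → ℝ := fun x => v x - (g x - a ^ 2 / c ^ 2 / 2 * ‖x‖ ^ 2) with hφ
  have hφc : ConvexOn ℝ Set.univ φ := hv.sub hg
  have hφm : Measurable φ := hφc.locallyLipschitz.continuous.measurable
  have hvm : Measurable v := hv.locallyLipschitz.continuous.measurable
  have hgm : Measurable g := by
    have h1 := hg.locallyLipschitz.continuous.measurable
    have h2 : Measurable fun x : 𝔼 => a ^ 2 / c ^ 2 / 2 * ‖x‖ ^ 2 := by fun_prop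
    convert h1.add h2 using 1
    funext x
    simp
  set T : 𝔼 → 𝔼 → ℝ≥0∞ := fun y z =>
    ENNReal.ofReal (Z * Real.exp (φ (a • y + z) - 1 / (2 * c ^ 2) * ‖z‖ ^ 2)) with hT
  have hTm : ∀ y, Measurable (T y) := fun y => by fun_prop
  have hu : ∀ y, ENNReal.ofReal (Real.exp (-(a ^ 2 / c ^ 2 / 2 * ‖y‖ ^ 2))) *
      laplaceExp (a / c ^ 2) μ g y = ∫⁻ z, T y z := by
    intro y
    have hsh := lintegral_add_left_eq_self (μ := (volume : Measure 𝔼))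
      (fun x => ENNReal.ofReal (Z * Real.exp (φ x - 1 / (2 * c ^ 2) * ‖x - a • y‖ ^ 2))) (a • y)
    simp only [add_sub_cancel_left] at hsh
    rw [hT, hsh]
    unfold laplaceExp
    rw [hμ, hγ, lintegral_withDensity_eq_lintegral_mul _ (by fun_prop) (by fun_prop),
      lintegral_withDensity_eq_lintegral_mul _ (by fun_prop) (by fun_prop),
      ← lintegral_const_mul _ (by fun_prop)]
    refine lintegral_congr fun x => ?_
    simp only [Pi.mul_apply]
    rw [← ENNReal.ofReal_mul (by positivity), ← ENNReal.ofReal_mul (by positivity),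
      ← ENNReal.ofReal_mul (by positivity)]
    congr 1
    rw [show ∀ p r s t : ℝ, p * (Z * r * (s * t)) = Z * (p * r * s * t) from
      fun p r s t => by ring, ← Real.exp_add, ← Real.exp_add, ← Real.exp_add]
    congr 2
    rw [hφ, norm_sub_sq_real, norm_smul, inner_smul_right, mul_pow]
    simp only [Real.norm_eq_abs, sq_abs]
    have h1 : a ^ 2 = 1 - c ^ 2 := by linarith
    field_simp
    rw [h1]
    ring
  have hinv : ∀ y, ENNReal.ofReal (Real.exp (a ^ 2 / c ^ 2 / 2 * ‖y‖ ^ 2)) *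
      (laplaceExp (a / c ^ 2) μ g y)⁻¹ = (∫⁻ z, T y z)⁻¹ := by
    intro y
    rw [← hu y, ENNReal.mul_inv (Or.inl (ENNReal.ofReal_exp_ne_zero _))
      (Or.inl ENNReal.ofReal_ne_top), ← ENNReal.ofReal_inv_of_pos (Real.exp_pos _), ← Real.exp_neg,
      neg_neg]
  simp_rw [hinv]
  have hTint : ∀ y, ∫⁻ z, T y z ≠ 0 := fun y => by
    rw [← hu y]
    exact mul_ne_zero (ENNReal.ofReal_exp_ne_zero _) (h0 y)
  intro x y s t hs ht hst
  have hpow : ∀ y (r : ℝ), 0 < r → (∫⁻ z, T y z) ^ r ≠ 0 := fun y r hr => by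
    simp [hTint y, hr.le, hr]
  rw [ENNReal.inv_rpow, ENNReal.inv_rpow,
    ← ENNReal.mul_inv (Or.inl (hpow x s hs)) (Or.inr (hpow y t ht))]
  refine ENNReal.inv_le_inv.2 ?_
  refine le_trans (lintegral_mono fun z => ?_)
    (ENNReal.lintegral_mul_norm_pow_le (hTm x).aemeasurable (hTm y).aemeasurable hs.le ht.le hst)
  simp only [hT]
  have hpos : ∀ r : ℝ, 0 < Z * Real.exp r := fun r => by positivity
  rw [ENNReal.ofReal_rpow_of_pos (hpos _), ENNReal.ofReal_rpow_of_pos (hpos _),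
    ← ENNReal.ofReal_mul (by positivity)]
  refine ENNReal.ofReal_le_ofReal ?_
  rw [Real.mul_rpow hZ.le (Real.exp_pos _).le, Real.mul_rpow hZ.le (Real.exp_pos _).le,
    ← Real.exp_mul, ← Real.exp_mul,
    show ∀ p q r u : ℝ, p * q * (r * u) = (p * r) * (q * u) from fun p q r u => by ring,
    ← Real.rpow_add hZ, hst, Real.rpow_one, ← Real.exp_add]
  refine mul_le_mul_of_nonneg_left (Real.exp_le_exp.2 ?_) hZ.le
  have h1 := hφc.2 (Set.mem_univ (a • x + z)) (Set.mem_univ (a • y + z)) hs.le ht.le hst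
  have h2 : s • (a • x + z) + t • (a • y + z) = a • (s • x + t • y) + z := by
    have : z = (s + t) • z := by rw [hst, one_smul]
    conv_rhs => rw [this]
    module
  rw [h2] at h1
  simp only [smul_eq_mul] at h1
  rw [show ∀ p q r : ℝ, (p - r) * s + (q - r) * t = s * p + t * q - (s + t) * r from
    fun p q r => by ring, hst, one_mul]
  linarith

/-- Existence of Schrödinger potentials with the convexity properties inherited from the
marginals. -/
theorem exists_concave_schrodinger_potential [IsProbabilityMeasure μ] [IsProbabilityMeasure ν]
    (ha : 0 ≤ a) (hc : 0 < c) (hac : a ^ 2 + c ^ 2 = 1) {v : 𝔼 → ℝ} {f : 𝔼 → ℝ≥0∞}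
    (hv : ConvexOn ℝ Set.univ v)
    (hμ : μ = (stdGaussian 𝔼).withDensity fun x => ENNReal.ofReal (Real.exp (v x)))
    (hμ1 : Integrable (fun x : 𝔼 => x) μ)
    (hf : Measurable f) (hfLC : IsLogConcave f) (hν : ν = (stdGaussian 𝔼).withDensity f)
    {ρ : ℝ} (hρ : ∀ᵐ y ∂ν, ‖y‖ ≤ ρ) :
    ∃ (g : 𝔼 → ℝ) (L : NNReal), LipschitzWith L g ∧ HasIntegrableLog (a / c ^ 2) μ ν g ∧
      (∀ y, laplaceExp (a / c ^ 2) μ g y ≠ 0) ∧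
      (IsLogConcave fun y => f y * ENNReal.ofReal (Real.exp (a ^ 2 / c ^ 2 / 2 * ‖y‖ ^ 2)) *
        (laplaceExp (a / c ^ 2) μ g y)⁻¹) ∧
      ∀ᵐ x ∂μ, ENNReal.ofReal (Real.exp (-g x)) *
        laplaceWeight (a / c ^ 2) ν (fun y => (laplaceExp (a / c ^ 2) μ g y)⁻¹) x = 1 := by
  set b := a / c ^ 2 with hb
  have hb0 : 0 ≤ b := by positivity
  set κ := a ^ 2 / c ^ 2 / 2 with hκ
  have hκ0 : 0 ≤ κ := by positivity
  set L : NNReal := (b * ρ).toNNReal with hLdef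
  have hL : b * ρ ≤ L := Real.le_coe_toNNReal _
  set 𝒞 : Set (𝔼 → ℝ) := {g | LipschitzWith L g ∧ g 0 = 0 ∧
    ConcaveOn ℝ Set.univ (fun x => g x - κ * ‖x‖ ^ 2)} with h𝒞
  have hpos : ∀ g : 𝔼 → ℝ, Measurable g → ∀ y, laplaceExp b μ g y ≠ 0 := by
    intro g hg y
    rw [laplaceExp, ne_eq, lintegral_eq_zero_iff (by fun_prop)]
    intro h
    obtain ⟨x, hx⟩ := h.exists
    exact ENNReal.ofReal_exp_ne_zero _ hx
  have hLC : ∀ g ∈ 𝒞, IsLogConcave fun y => f y * ENNReal.ofReal (Real.exp (κ * ‖y‖ ^ 2)) *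
      (laplaceExp b μ g y)⁻¹ := fun g hg => by
    have := hfLC.mul (isLogConcave_inv_laplaceExp hc hac hv hμ hg.2.2
      (hpos g hg.1.continuous.measurable))
    simpa only [mul_assoc] using this
  have hmem : ∀ k : 𝔼 → ℝ≥0∞, Measurable k → ∀ B : ℝ≥0∞, B ≠ ∞ → (∀ᵐ y ∂ν, k y ≤ B) →
      (∀ᵐ y ∂ν, k y ≠ 0) →
      (IsLogConcave fun y => f y * ENNReal.ofReal (Real.exp (κ * ‖y‖ ^ 2)) * k y) →
      (fun x => logLaplace b ν k x - logLaplace b ν k 0) ∈ 𝒞 := by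
    intro k hk B hB hkB hk0 hkLC
    have hGL := logLaplace_lipschitzWith hB hb0 hρ hL hk hkB hk0
    refine ⟨LipschitzWith.of_dist_le_mul fun x y => by simpa using hGL.dist_le_mul x y,
      sub_self _, ?_⟩
    have := (concaveOn_logLaplace_sub hc hac hf hk hν hkLC (laplaceWeight_ne_zero hk hk0)
      (laplaceWeight_ne_top hB hb0 hρ hkB)).sub (convexOn_const (logLaplace b ν k 0) convex_univ)
    refine this.congr fun x _ => ?_
    simp only [Pi.sub_apply]
    ring
  have hmain := exists_schrodinger_potential (μ := μ) (ν := ν) hμ1 hb0 hL hρ 𝒞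
    (fun g hg => hg.1) (fun g hg => hg.2.1) ?_ ?_ ?_
  · obtain ⟨g, hg, h1, h2⟩ := hmain
    exact ⟨g, L, hg.1, h1, hpos g hg.1.continuous.measurable, hLC g hg, h2⟩
  · intro u g hu hgL hlim
    refine ⟨hgL, ?_, convex_univ, fun x _ y _ s t hs ht hst => ?_⟩
    · refine tendsto_nhds_unique (hlim 0) ?_
      simp [(hu _).2.1]
    · exact le_of_tendsto_of_tendsto' ((((hlim x).sub_const _).const_smul s).add
        (((hlim y).sub_const _).const_smul t)) ((hlim _).sub_const _) fun n =>
        (hu n).2.2.2 (Set.mem_univ x) (Set.mem_univ y) hs ht hst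
  · set k : 𝔼 → ℝ≥0∞ := fun y => ENNReal.ofReal (Real.exp (-(κ * ‖y‖ ^ 2))) with hk
    have hkm : Measurable k := by fun_prop
    have hk1 : ∀ y, k y ≤ 1 := fun y => by
      rw [hk, ENNReal.ofReal_le_one, Real.exp_le_one_iff, neg_nonpos]
      positivity
    have hk0 : ∀ y, k y ≠ 0 := fun y => ENNReal.ofReal_exp_ne_zero _
    have hki : Integrable (fun y => Real.log (k y).toReal) ν := by
      have e : ∀ y, Real.log (k y).toReal = -(κ * ‖y‖ ^ 2) := fun y => by
        rw [hk, ENNReal.toReal_ofReal (Real.exp_pos _).le, Real.log_exp]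
      simp_rw [e]
      refine Integrable.mono' (integrable_const (κ * ρ ^ 2)) (by fun_prop) ?_
      filter_upwards [hρ] with y hy
      rw [norm_neg, Real.norm_of_nonneg (by positivity)]
      gcongr
    refine ⟨_, hmem k hkm 1 ENNReal.one_ne_top (Filter.Eventually.of_forall hk1)
      (Filter.Eventually.of_forall hk0) ?_,
      (HasIntegrableLog.logLaplace_sub hb0 hL hρ hkm ENNReal.one_ne_top
      (Filter.Eventually.of_forall hk1) (Filter.Eventually.of_forall hk0) hki).1⟩
    convert hfLC using 2 with y
    rw [mul_assoc, hk, ← ENNReal.ofReal_mul (Real.exp_pos _).le, ← Real.exp_add, add_neg_cancel,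
      Real.exp_zero, ENNReal.ofReal_one, mul_one]
  · intro g hg hgfin
    obtain ⟨M, hM⟩ := exists_le_laplaceExp (μ := μ) (L := L) hb0 hL
    refine hmem _ (measurable_laplaceExp hg.1.continuous.measurable).inv
      (ENNReal.ofReal (Real.exp (-M)))⁻¹ (ENNReal.inv_ne_top.2 (ENNReal.ofReal_exp_ne_zero _))
      (hρ.mono fun y hy => ENNReal.inv_le_inv.2 (hM g hg.1 hg.2.1 y hy))
      (hgfin.1.mono fun y hy => ENNReal.inv_ne_zero.2 hy) (hLC g hg)

end Potentials

section Entropy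

variable {X : Type*} [MeasurableSpace X] {Q P : Measure X} {h : X → ℝ≥0∞}

theorem klDiv_withDensity_eq [IsProbabilityMeasure Q] [IsProbabilityMeasure P] (hh : Measurable h)
    (hP : P = Q.withDensity h) (hi : Integrable (fun x => Real.log (h x).toReal) P) :
    InformationTheory.klDiv P Q = ENNReal.ofReal (∫ x, Real.log (h x).toReal ∂P) := by
  have hac : P ≪ Q := hP ▸ withDensity_absolutelyContinuous _ _
  have hllr : llr P Q =ᵐ[P] fun x => Real.log (h x).toReal := by
    refine hac.ae_le ?_
    have : P.rnDeriv Q =ᵐ[Q] h := hP ▸ Measure.rnDeriv_withDensity Q hh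
    filter_upwards [this] with x hx
    rw [llr, hx]
  rw [InformationTheory.klDiv_of_ac_of_integrable hac (hi.congr hllr.symm), integral_congr_ae hllr]
  simp

/-- The Gibbs variational inequality. -/
theorem ofReal_integral_log_le_klDiv [IsProbabilityMeasure Q] [IsProbabilityMeasure P]
    (hh : Measurable h) (h1 : ∫⁻ x, h x ∂Q ≤ 1) (h0 : ∀ᵐ x ∂P, h x ≠ 0) (ht : ∀ᵐ x ∂P, h x ≠ ∞)
    (hi : Integrable (fun x => Real.log (h x).toReal) P) :
    ENNReal.ofReal (∫ x, Real.log (h x).toReal ∂P) ≤ InformationTheory.klDiv P Q := by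
  by_cases hk : InformationTheory.klDiv P Q = ∞
  · rw [hk]
    exact le_top
  obtain ⟨hac, hllr⟩ := InformationTheory.klDiv_ne_top_iff.1 hk
  rw [InformationTheory.klDiv_of_ac_of_integrable hac hllr]
  refine ENNReal.ofReal_le_ofReal ?_
  simp only [probReal_univ, add_sub_cancel_right]
  set p := P.rnDeriv Q with hp
  have hpm : Measurable p := Measure.measurable_rnDeriv P Q
  have hPp : P = Q.withDensity p := (Measure.withDensity_rnDeriv_eq P Q hac).symm
  have hqm : Measurable fun x => h x * (p x)⁻¹ := hh.mul hpm.inv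
  have hq : ∫⁻ x, h x * (p x)⁻¹ ∂P ≤ 1 := by
    rw [hPp, lintegral_withDensity_eq_lintegral_mul _ hpm hqm]
    refine le_trans (lintegral_mono fun x => ?_) h1
    simp only [Pi.mul_apply]
    calc p x * (h x * (p x)⁻¹) = h x * (p x * (p x)⁻¹) := by ring
      _ ≤ h x * 1 := by gcongr; exact ENNReal.mul_inv_le_one _
      _ = h x := mul_one _
  have hqt : ∫⁻ x, h x * (p x)⁻¹ ∂P ≠ ∞ := ne_top_of_le_ne_top ENNReal.one_ne_top hq
  have hqi : Integrable (fun x => (h x * (p x)⁻¹).toReal) P :=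
    integrable_toReal_of_lintegral_ne_top hqm.aemeasurable hqt
  have hqint : ∫ x, (h x * (p x)⁻¹).toReal ∂P ≤ 1 := by
    rw [integral_toReal hqm.aemeasurable (ae_lt_top hqm hqt)]
    exact ENNReal.toReal_le_of_le_ofReal zero_le_one (by simpa using hq)
  have hle : ∫ x, (Real.log (h x).toReal - llr P Q x) ∂P ≤
      ∫ x, ((h x * (p x)⁻¹).toReal - 1) ∂P := by
    refine integral_mono_ae (hi.sub hllr) (hqi.sub (integrable_const 1)) ?_
    filter_upwards [h0, ht, Measure.rnDeriv_pos hac,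
      hac.ae_le (Measure.rnDeriv_lt_top P Q)] with x hx0 hxt hp0 hpt
    have a1 := ENNReal.toReal_pos hx0 hxt
    have a2 := ENNReal.toReal_pos hp0.ne' hpt.ne
    have a3 := Real.log_le_sub_one_of_pos (mul_pos a1 (inv_pos.2 a2))
    rw [Real.log_mul a1.ne' (inv_pos.2 a2).ne', Real.log_inv] at a3
    rw [ENNReal.toReal_mul, ENNReal.toReal_inv, llr]
    linarith
  rw [integral_sub hi hllr, integral_sub hqi (integrable_const 1)] at hle
  simp only [integral_const, probReal_univ, one_smul] at hle
  linarith

/-- The logarithm of a probability density which is bounded above is integrable. -/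
theorem integrable_log_of_withDensity [IsProbabilityMeasure Q] [IsProbabilityMeasure P]
    (hh : Measurable h) (hP : P = Q.withDensity h) (ht : ∀ x, h x ≠ ∞) {B : ℝ}
    (hB : ∀ᵐ x ∂P, Real.log (h x).toReal ≤ B) :
    Integrable (fun x => Real.log (h x).toReal) P := by
  have hm : Measurable fun x => B - Real.log (h x).toReal := by
    have := hh.ennreal_toReal
    fun_prop
  have hint : ∫⁻ x, h x ∂Q = 1 := by
    have := measure_univ (μ := P)
    rwa [hP, withDensity_apply _ MeasurableSet.univ, Measure.restrict_univ] at this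
  have hfin : Integrable (fun x => B - Real.log (h x).toReal) P := by
    refine ⟨hm.aestronglyMeasurable, ?_⟩
    rw [hasFiniteIntegral_iff_ofReal (hB.mono fun x hx => sub_nonneg.2 hx), hP,
      lintegral_withDensity_eq_lintegral_mul _ hh hm.ennreal_ofReal]
    calc _ ≤ ∫⁻ x, (1 + ENNReal.ofReal |B| * h x) ∂Q := by
          refine lintegral_mono fun x => ?_
          simp only [Pi.mul_apply]
          rcases eq_or_ne (h x) 0 with hx | hx
          · simp [hx]
          have hpos := ENNReal.toReal_pos hx (ht x)
          set t := (h x).toReal with htd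
          have hht : h x = ENNReal.ofReal t := (ENNReal.ofReal_toReal (ht x)).symm
          rw [hht, ← ENNReal.ofReal_mul hpos.le, ← ENNReal.ofReal_mul (abs_nonneg B),
            ← ENNReal.ofReal_one, ← ENNReal.ofReal_add zero_le_one (by positivity)]
          refine ENNReal.ofReal_le_ofReal ?_
          have h1 := Real.one_sub_inv_le_log_of_pos hpos
          have h2 : t * (1 - t⁻¹) = t - 1 := by field_simp
          have h3 := mul_le_mul_of_nonneg_left h1 hpos.le
          have h4 := mul_le_mul_of_nonneg_right (le_abs_self B) hpos.le
          nlinarith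
      _ = 1 + ENNReal.ofReal |B| * 1 := by
          rw [lintegral_add_left measurable_const, lintegral_const_mul _ hh, hint]
          simp
      _ < ∞ := by simp
  have := (integrable_const B).sub hfin
  refine this.congr (Filter.Eventually.of_forall fun x => ?_)
  simp

end Entropy

section Final

variable {d : ℕ}

local notation "𝔼" => EuclideanSpace ℝ (Fin d)

theorem ouCoupling_isProbabilityMeasure (d : ℕ) (ε : ℝ) :
    IsProbabilityMeasure (ouCoupling d ε) :=
  Measure.isProbabilityMeasure_map (by fun_prop)

theorem snd_absolutelyContinuous {ε : ℝ} (hε : 0 < ε) {π : Measure (𝔼 × 𝔼)}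
    (h : π ≪ ouCoupling d ε) : π.map Prod.snd ≪ (volume : Measure 𝔼) := by
  obtain ⟨C, hC, hR⟩ := exists_ouCoupling_eq_withDensity d hε
  have h1 : π ≪ (volume : Measure 𝔼).prod volume :=
    h.trans (hR ▸ withDensity_absolutelyContinuous _ _)
  exact (h1.map measurable_snd).trans Measure.quasiMeasurePreserving_snd.absolutelyContinuous

/-- The Schrödinger coupling: a coupling of `μ` and `ν` whose density with respect to the
Ornstein-Uhlenbeck coupling is a product of potentials, the second of them log-concave. -/
theorem exists_schrodinger_coupling {μ ν : Measure 𝔼} [IsProbabilityMeasure μ]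
    [IsProbabilityMeasure ν] {v : 𝔼 → ℝ} {f : 𝔼 → ℝ≥0∞} (hv : ConvexOn ℝ Set.univ v)
    (hμ : μ = (stdGaussian 𝔼).withDensity fun x => ENNReal.ofReal (Real.exp (v x)))
    {m : ℝ} (hm : ∀ x, m ≤ v x) (hμ2 : MemLp (fun x : 𝔼 => x) 2 μ)
    (hf : Measurable f) (hft : ∀ x, f x ≠ ∞) (hfLC : IsLogConcave f)
    (hν : ν = (stdGaussian 𝔼).withDensity f)
    {ρ : ℝ} (hρ : ∀ᵐ y ∂ν, ‖y‖ ≤ ρ) {ε : ℝ} (hε : 0 < ε) :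
    ∃ (φ : 𝔼 → ℝ) (Ψ : 𝔼 → ℝ≥0∞) (π : Measure (𝔼 × 𝔼)), Measurable φ ∧ Measurable Ψ ∧
      Integrable φ μ ∧ IsLogConcave Ψ ∧ (∀ y, Ψ y ≠ ∞) ∧ (∀ᵐ y ∂ν, Ψ y ≠ 0) ∧
      Integrable (fun y => Real.log (Ψ y).toReal) ν ∧ π ∈ couplingSet μ ν ∧
      π = (ouCoupling d ε).withDensity
        (fun p => ENNReal.ofReal (Real.exp (φ p.1)) * Ψ p.2) := by
  set a := Real.exp (-ε / 2) with ha
  set c := Real.sqrt (1 - Real.exp (-ε)) with hcdef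
  have h1 : 0 < 1 - Real.exp (-ε) := by simpa using hε
  have hc : 0 < c := Real.sqrt_pos.2 h1
  have hc2 : 1 - Real.exp (-ε) = c ^ 2 := (Real.sq_sqrt h1.le).symm
  have hac : a ^ 2 + c ^ 2 = 1 := by
    rw [← hc2, ha, ← Real.exp_nat_mul]
    push_cast
    ring_nf
  have hμ1 : Integrable (fun x : 𝔼 => x) μ := hμ2.integrable (by norm_num)
  obtain ⟨g, L, hgL, hgfin, hu0, hΨLC, hfix⟩ := exists_concave_schrodinger_potential
    (Real.exp_pos _).le hc hac hv hμ hμ1 hf hfLC hν hρ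
  obtain ⟨Z, hZ, hγ⟩ := exists_stdGaussian_eq_withDensity (E := EuclideanSpace ℝ (Fin d))
  obtain ⟨C, hC, hR⟩ := exists_ouCoupling_eq_withDensity d hε
  rw [← ha, hc2] at hR
  set b := a / c ^ 2 with hb
  set κ := a ^ 2 / c ^ 2 / 2 with hκ
  set u := laplaceExp b μ g with hu
  have hgm : Measurable g := hgL.continuous.measurable
  have hvm : Measurable v := hv.locallyLipschitz.continuous.measurable
  have hum : Measurable u := measurable_laplaceExp hgm
  set K : ℝ := Real.log (Z * Z / C) with hK
  have hKexp : Real.exp K = Z * Z / C := Real.exp_log (by positivity)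
  set φ : 𝔼 → ℝ := fun x => v x + κ * ‖x‖ ^ 2 - g x + K with hφ
  set Ψ : 𝔼 → ℝ≥0∞ := fun y => f y * ENNReal.ofReal (Real.exp (κ * ‖y‖ ^ 2)) * (u y)⁻¹ with hΨ
  have hφm : Measurable φ := by fun_prop
  have hΨm : Measurable Ψ := by fun_prop
  set θ : 𝔼 × 𝔼 → ℝ≥0∞ := fun p =>
    ENNReal.ofReal (Real.exp (b * inner ℝ p.1 p.2 - g p.1)) * (u p.2)⁻¹ with hθ
  have hθm : Measurable θ := by fun_prop
  have hf0 : ∀ᵐ y ∂ν, f y ≠ 0 := by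
    rw [hν, ae_withDensity_iff hf]
    exact Filter.Eventually.of_forall fun y hy => hy
  -- second moment of `μ`
  have hsq : Integrable (fun x : 𝔼 => ‖x‖ ^ 2) μ := hμ2.integrable_norm_pow (by norm_num)
  have hvi : Integrable v μ := by
    have hfin : ∫⁻ x, ENNReal.ofReal (Real.exp (v x)) ∂(stdGaussian 𝔼) ≠ ∞ := by
      have := measure_univ (μ := μ)
      rw [hμ, withDensity_apply _ MeasurableSet.univ, Measure.restrict_univ] at this
      simp [this]
    obtain ⟨B, hB⟩ := hv.exists_le_sq_of_lintegral_exp hfin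
    exact integrable_of_le_of_le hvm.aestronglyMeasurable (Filter.Eventually.of_forall hm)
      (Filter.Eventually.of_forall hB) (integrable_const m) ((integrable_const B).add hsq)
  have hφi : Integrable φ μ :=
    ((hvi.add (hsq.const_mul κ)).sub (integrable_of_lipschitzWith hμ1 hgL)).add (integrable_const K)
  have hΨt : ∀ y, Ψ y ≠ ∞ := fun y => ENNReal.mul_ne_top
    (ENNReal.mul_ne_top (hft y) ENNReal.ofReal_ne_top) (ENNReal.inv_ne_top.2 (hu0 y))
  have hΨ0 : ∀ᵐ y ∂ν, Ψ y ≠ 0 := by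
    filter_upwards [hf0, hgfin.1] with y h2 h3
    exact mul_ne_zero (mul_ne_zero h2 (ENNReal.ofReal_exp_ne_zero _)) (ENNReal.inv_ne_zero.2 h3)
  -- integrability of `log Ψ`
  have hνvol : ν ≪ (volume : Measure 𝔼) :=
    (hν ▸ withDensity_absolutelyContinuous _ _ : ν ≪ stdGaussian 𝔼).trans
      stdGaussian_absolutelyContinuous
  have hfcon := hfLC.concaveOn_log hft
  have hfi : Integrable (fun y => Real.log (f y).toReal) ν := by
    have hfr : ∀ᵐ y ∂ν, y ∉ frontier {x | f x ≠ 0} :=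
      hνvol.ae_le (measure_eq_zero_iff_ae_notMem.1 (hfcon.1.addHaar_frontier volume))
    obtain ⟨x₀, hx₀, hx₀'⟩ := (hf0.and hfr).exists
    have hint : x₀ ∈ interior {x | f x ≠ 0} := by
      by_contra hn
      exact hx₀' ⟨subset_closure hx₀, hn⟩
    obtain ⟨K', hK'0, hK'⟩ := hfcon.neg.exists_sub_mul_norm_le hint
    refine integrable_log_of_withDensity (B := Real.log (f x₀).toReal + K' * (ρ + ‖x₀‖)) hf hν hft ?_
    filter_upwards [hf0, hρ] with y h2 h3
    have h4 := hK' y h2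
    simp only [Pi.neg_apply] at h4
    have h5 : K' * ‖y - x₀‖ ≤ K' * (ρ + ‖x₀‖) :=
      mul_le_mul_of_nonneg_left ((norm_sub_le y x₀).trans (by gcongr)) hK'0
    linarith
  have hΨi : Integrable (fun y => Real.log (Ψ y).toReal) ν := by
    have hsqν : Integrable (fun y : 𝔼 => κ * ‖y‖ ^ 2) ν := by
      refine Integrable.mono' (integrable_const (κ * ρ ^ 2)) (by fun_prop) ?_
      filter_upwards [hρ] with y hy
      rw [Real.norm_of_nonneg (by positivity)]
      gcongr
    refine ((hfi.add hsqν).sub hgfin.2).congr ?_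
    filter_upwards [hf0, hgfin.1] with y h2 h3
    have a1 := ENNReal.toReal_pos h2 (hft y)
    have a2 := ENNReal.toReal_pos (hu0 y) h3
    simp only [Pi.add_apply, Pi.sub_apply, hΨ]
    rw [ENNReal.toReal_mul, ENNReal.toReal_mul, ENNReal.toReal_inv,
      ENNReal.toReal_ofReal (Real.exp_pos _).le, Real.log_mul (by positivity) (by positivity),
      Real.log_mul a1.ne' (Real.exp_pos _).ne', Real.log_exp, Real.log_inv]
    ring
  -- marginals
  have hmarg1 : ((μ.prod ν).withDensity θ).map Prod.fst = μ := by
    refine Measure.ext_of_lintegral _ fun q hq => ?_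
    rw [lintegral_map hq measurable_fst, lintegral_withDensity_eq_lintegral_mul _ hθm (by fun_prop),
      lintegral_prod _ (by fun_prop)]
    refine lintegral_congr_ae ?_
    filter_upwards [hfix] with x hx
    calc _ = ∫⁻ y, q x * (ENNReal.ofReal (Real.exp (-g x)) *
          (ENNReal.ofReal (Real.exp (b * inner ℝ x y)) * (u y)⁻¹)) ∂ν := by
          refine lintegral_congr fun y => ?_
          simp only [Pi.mul_apply, hθ]
          rw [← mul_assoc (ENNReal.ofReal (Real.exp (-g x))), ← ENNReal.ofReal_mul (Real.exp_pos _).le,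
            ← Real.exp_add, mul_comm]
          congr 4
          ring
      _ = q x * 1 := by
          rw [lintegral_const_mul _ (by fun_prop), lintegral_const_mul _ (by fun_prop), ← hx]
          rfl
      _ = q x := mul_one _
  have hmarg2 : ((μ.prod ν).withDensity θ).map Prod.snd = ν := by
    refine Measure.ext_of_lintegral _ fun q hq => ?_
    rw [lintegral_map hq measurable_snd, lintegral_withDensity_eq_lintegral_mul _ hθm (by fun_prop),
      lintegral_prod_symm _ (by fun_prop)]
    refine lintegral_congr_ae ?_
    filter_upwards [hgfin.1] with y hy
    calc _ = ∫⁻ x, ENNReal.ofReal (Real.exp (b * inner ℝ x y - g x)) * ((u y)⁻¹ * q y) ∂μ := by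
          refine lintegral_congr fun x => ?_
          simp only [Pi.mul_apply, hθ]
          ring
      _ = u y * ((u y)⁻¹ * q y) := lintegral_mul_const _ (by fun_prop)
      _ = q y := by rw [← mul_assoc, ENNReal.mul_inv_cancel (hu0 y) hy, one_mul]
  have hprob : IsProbabilityMeasure ((μ.prod ν).withDensity θ) := by
    have : IsProbabilityMeasure (((μ.prod ν).withDensity θ).map Prod.fst) := hmarg1.symm ▸ ‹_›
    exact Measure.isProbabilityMeasure_of_map Prod.fst
  refine ⟨φ, Ψ, (μ.prod ν).withDensity θ, hφm, hΨm, hφi, hΨLC, hΨt, hΨ0, hΨi,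
    ⟨hprob, hmarg1, hmarg2⟩, ?_⟩
  rw [hR, hμ, hν, hγ, ← withDensity_mul _ (by fun_prop) (by fun_prop),
    ← withDensity_mul _ (by fun_prop) hf, prod_withDensity (by fun_prop) (by fun_prop),
    ← Measure.volume_eq_prod, ← withDensity_mul _ (by fun_prop) (by fun_prop),
    ← withDensity_mul _ (by fun_prop) (by fun_prop)]
  congr 1
  funext p
  simp only [Pi.mul_apply, hθ, hΨ, hφ]
  have key : ENNReal.ofReal (Z * Real.exp (-‖p.1‖ ^ 2 / 2)) * ENNReal.ofReal (Real.exp (v p.1)) *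
      ENNReal.ofReal (Z * Real.exp (-‖p.2‖ ^ 2 / 2)) *
      ENNReal.ofReal (Real.exp (b * inner ℝ p.1 p.2 - g p.1)) =
      ENNReal.ofReal (C * Real.exp (-(‖p.1‖ ^ 2 + ‖p.2‖ ^ 2 - 2 * a * inner ℝ p.1 p.2) /
          (2 * c ^ 2))) *
      ENNReal.ofReal (Real.exp (v p.1 + κ * ‖p.1‖ ^ 2 - g p.1 + K)) *
      ENNReal.ofReal (Real.exp (κ * ‖p.2‖ ^ 2)) := by
    rw [← ENNReal.ofReal_mul (by positivity), ← ENNReal.ofReal_mul (by positivity),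
      ← ENNReal.ofReal_mul (by positivity), ← ENNReal.ofReal_mul (by positivity),
      ← ENNReal.ofReal_mul (by positivity)]
    congr 1
    rw [Real.exp_add _ K, hKexp]
    calc _ = Z * Z * (Real.exp (-‖p.1‖ ^ 2 / 2) * Real.exp (v p.1) * Real.exp (-‖p.2‖ ^ 2 / 2) *
          Real.exp (b * inner ℝ p.1 p.2 - g p.1)) := by ring
      _ = Z * Z * (Real.exp (-(‖p.1‖ ^ 2 + ‖p.2‖ ^ 2 - 2 * a * inner ℝ p.1 p.2) / (2 * c ^ 2)) *
          Real.exp (v p.1 + κ * ‖p.1‖ ^ 2 - g p.1) * Real.exp (κ * ‖p.2‖ ^ 2)) := by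
          congr 1
          rw [← Real.exp_add, ← Real.exp_add, ← Real.exp_add, ← Real.exp_add, ← Real.exp_add]
          congr 1
          rw [hb, hκ]
          have h1 : a ^ 2 = 1 - c ^ 2 := by linarith
          field_simp
          rw [h1]
          ring
      _ = _ := by
          field_simp
  calc _ = (ENNReal.ofReal (Z * Real.exp (-‖p.1‖ ^ 2 / 2)) * ENNReal.ofReal (Real.exp (v p.1)) *
      ENNReal.ofReal (Z * Real.exp (-‖p.2‖ ^ 2 / 2)) *
      ENNReal.ofReal (Real.exp (b * inner ℝ p.1 p.2 - g p.1))) * (f p.2 * (u p.2)⁻¹) := by ring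
    _ = _ := by rw [key]; ring

theorem mainTheorem2 (d : ℕ)
    (μ ν : Measure (EuclideanSpace ℝ (Fin d))) [IsProbabilityMeasure μ] [IsProbabilityMeasure ν]
    (V W : EuclideanSpace ℝ (Fin d) → EReal) (hV : IsConvexExt V) (hW : IsConvexExt W)
    (hμ : μ = (stdGaussian (EuclideanSpace ℝ (Fin d))).withDensity (fun x => EReal.exp (V x)))
    (hν : ν = (stdGaussian (EuclideanSpace ℝ (Fin d))).withDensity (fun x => EReal.exp (-W x)))
    (hμ2 : MemLp (fun x : EuclideanSpace ℝ (Fin d) => x) 2 μ)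
    (hνc : IsCompact ν.support)
    (hVb : ∃ m : ℝ, ∀ x, (m : EReal) ≤ V x)
    (ε : ℝ) (hε : 0 < ε)
    (η : Measure (EuclideanSpace ℝ (Fin d))) [IsProbabilityMeasure η] (hη : ConvexOrderLE η ν) :
    entropicCost ε μ η ≥ entropicCost ε μ ν := by
  obtain ⟨m, hm⟩ := hVb
  have hVfin : ∫⁻ x, EReal.exp (V x) ∂(stdGaussian (EuclideanSpace ℝ (Fin d))) ≠ ∞ := by
    have := measure_univ (μ := μ)
    rw [hμ, withDensity_apply _ MeasurableSet.univ, Measure.restrict_univ] at this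
    simp [this]
  obtain ⟨v, hv, hVv⟩ := hV.exists_real_of_lintegral_exp_ne_top hVfin
  simp only [hVv, EReal.exp_coe] at hμ
  have hmv : ∀ x, m ≤ v x := fun x => by
    have := hm x
    rw [hVv] at this
    exact_mod_cast this
  obtain ⟨D, w, hD, hw, hνw⟩ := hW.exists_open_withDensity_eq
  rw [hνw] at hν
  have hwm : Measurable (D.indicator fun x => ENNReal.ofReal (Real.exp (-w x))) := by
    have hc : ContinuousOn (fun x => ENNReal.ofReal (Real.exp (-w x))) D :=
      ENNReal.continuous_ofReal.comp_continuousOn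
        (Real.continuous_exp.comp_continuousOn (hw.continuousOn hD).neg)
    classical
    rw [← Set.piecewise_eq_indicator]
    exact hc.measurable_piecewise continuousOn_const hD.measurableSet
  have hwt : ∀ x, (D.indicator fun x => ENNReal.ofReal (Real.exp (-w x))) x ≠ ∞ := fun x => by
    by_cases hx : x ∈ D
    · rw [Set.indicator_of_mem hx]
      exact ENNReal.ofReal_ne_top
    · rw [Set.indicator_of_notMem hx]
      exact ENNReal.zero_ne_top
  obtain ⟨ρ, hρ⟩ := hνc.isBounded.exists_norm_le
  have hρ' : ∀ᵐ y ∂ν, ‖y‖ ≤ ρ := by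
    filter_upwards [Measure.support_mem_ae (μ := ν)] with y hy
    exact hρ y hy
  obtain ⟨φ, Ψ, π₀, hφm, hΨm, hφi, hΨLC, hΨt, hΨ0, hΨi, ⟨hπ₀, hπ₀1, hπ₀2⟩, hπ₀R⟩ :=
    exists_schrodinger_coupling hv hμ hmv hμ2 hwm hwt hw.isLogConcave_ofReal_exp_neg hν hρ' hε
  have hRprob := ouCoupling_isProbabilityMeasure d ε
  set h : EuclideanSpace ℝ (Fin d) × EuclideanSpace ℝ (Fin d) → ℝ≥0∞ :=
    fun p => ENNReal.ofReal (Real.exp (φ p.1)) * Ψ p.2 with hh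
  have hhm : Measurable h := by fun_prop
  have hint : ∀ (ζ : Measure (EuclideanSpace ℝ (Fin d)))
      (π : Measure (EuclideanSpace ℝ (Fin d) × EuclideanSpace ℝ (Fin d))), π.map Prod.fst = μ →
      π.map Prod.snd = ζ → (∀ᵐ y ∂ζ, Ψ y ≠ 0) → Integrable (fun y => Real.log (Ψ y).toReal) ζ →
      (∀ᵐ p ∂π, h p ≠ 0) ∧ Integrable (fun p => Real.log (h p).toReal) π ∧
      ∫ p, Real.log (h p).toReal ∂π = ∫ x, φ x ∂μ + ∫ y, Real.log (Ψ y).toReal ∂ζ := by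
    intro ζ π h1 h2 h3 h4
    have h3' : ∀ᵐ p ∂π, Ψ p.2 ≠ 0 := by
      rw [← h2] at h3
      exact ae_of_ae_map measurable_snd.aemeasurable h3
    have i1 : Integrable (fun p : EuclideanSpace ℝ (Fin d) × EuclideanSpace ℝ (Fin d) => φ p.1) π := by
      rw [← h1] at hφi
      exact hφi.comp_measurable measurable_fst
    have i2 : Integrable (fun p : EuclideanSpace ℝ (Fin d) × EuclideanSpace ℝ (Fin d) =>
        Real.log (Ψ p.2).toReal) π := by
      rw [← h2] at h4
      exact h4.comp_measurable measurable_snd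
    have hae : (fun p => Real.log (h p).toReal) =ᵐ[π]
        fun p => φ p.1 + Real.log (Ψ p.2).toReal := by
      filter_upwards [h3'] with p hp
      rw [hh, ENNReal.toReal_mul, ENNReal.toReal_ofReal (Real.exp_pos _).le,
        Real.log_mul (Real.exp_pos _).ne' (ENNReal.toReal_pos hp (hΨt _)).ne', Real.log_exp]
    refine ⟨h3'.mono fun p hp => mul_ne_zero (ENNReal.ofReal_exp_ne_zero _) hp,
      (i1.add i2).congr hae.symm, ?_⟩
    rw [integral_congr_ae hae, integral_add i1 i2, ← h1, ← h2,
      integral_map measurable_fst.aemeasurable hφm.aestronglyMeasurable,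
      integral_map (f := fun y => Real.log (Ψ y).toReal) measurable_snd.aemeasurable
        (Real.measurable_log.comp hΨm.ennreal_toReal).aestronglyMeasurable]
  obtain ⟨-, hi₀, he₀⟩ := hint ν π₀ hπ₀1 hπ₀2 hΨ0 hΨi
  have hcost : entropicCost ε μ ν ≤ ENNReal.ofReal (∫ p, Real.log (h p).toReal ∂π₀) := by
    rw [← klDiv_withDensity_eq hhm hπ₀R hi₀]
    exact iInf₂_le π₀ ⟨hπ₀, hπ₀1, hπ₀2⟩
  refine le_iInf₂ fun π hπ => ?_
  obtain ⟨hπp, hπ1, hπ2⟩ := hπ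
  by_cases htop : InformationTheory.klDiv π (ouCoupling d ε) = ∞
  · rw [htop]
    exact le_top
  have hac := (InformationTheory.klDiv_ne_top_iff.1 htop).1
  have hηvol : η ≪ volume := hπ2 ▸ snd_absolutelyContinuous hε hac
  have hνvol : ν ≪ volume :=
    (hν ▸ withDensity_absolutelyContinuous _ _ : ν ≪ stdGaussian _).trans
      stdGaussian_absolutelyContinuous
  have hcon := (hΨLC.concaveOn_log hΨt).neg
  have hfr := measure_eq_zero_iff_ae_notMem.1 (hcon.1.addHaar_frontier volume)
  have hne : (interior {y | Ψ y ≠ 0}).Nonempty := by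
    obtain ⟨x, hx, hx'⟩ := (hΨ0.and (hνvol.ae_le hfr)).exists
    refine ⟨x, ?_⟩
    by_contra hn
    exact hx' ⟨subset_closure hx, hn⟩
  have hηint : ∀ᵐ y ∂η, y ∈ interior {y | Ψ y ≠ 0} := by
    filter_upwards [hη.ae_mem_closure hcon.1 (hne.mono interior_subset) hΨ0, hηvol.ae_le hfr]
      with y hy hy'
    by_contra hn
    exact hy' ⟨hy, hn⟩
  obtain ⟨hηi, hηle⟩ := hη.integral_le_of_convexOn hcon hΨ0 hηint hne hΨi.neg
  have hηi' : Integrable (fun y => Real.log (Ψ y).toReal) η := by simpa using hηi.neg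
  simp only [Pi.neg_apply, integral_neg, neg_le_neg_iff] at hηle
  obtain ⟨h0π, hiπ, heπ⟩ := hint η π hπ1 hπ2
    (hηint.mono fun y hy => interior_subset (s := {y | Ψ y ≠ 0}) hy) hηi'
  have hone : ∫⁻ p, h p ∂(ouCoupling d ε) ≤ 1 := by
    have := measure_univ (μ := π₀)
    rw [hπ₀R, withDensity_apply _ MeasurableSet.univ, Measure.restrict_univ] at this
    exact this.le
  refine hcost.trans (le_trans (ENNReal.ofReal_le_ofReal ?_) (ofReal_integral_log_le_klDiv hhm hone
    h0π (Filter.Eventually.of_forall fun p => ENNReal.mul_ne_top ENNReal.ofReal_ne_top (hΨt _))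
    hiπ))
  rw [he₀, heπ]
  linarith

end Final
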